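/- Let $X$ be a complex Banach space with dual $X'$, write $\langle y,x\rangle=y(x)$ for $y\in X'$, $x\in X$, and let $A$ be the generator of an exponentially stable $C_0$-semigroup $(T(t))_{t\ge 0}$ on $X$. Let $\mathcal{H}^\infty_-$ be the set of bounded holomorphic functions on $\mathbb{C}_-=\{z\in\mathbb{C}:\operatorname{Re} z<0\}$, identified with their boundary functions on $i\mathbb{R}$. For $g\in\mathcal{H}^\infty_-$ let $$M_g:L^2(0,\infty)\to L^2(0,\infty),\qquad M_gf=\mathfrak{L}^{-1}\Pi(g\cdot\mathfrak{L}f),$$ where $\mathfrak{L}$ is the Laplace transform (as a function on $i\mathbb{R}$) and $\Pi$ is the orthogonal projection of $L^2(i\mathbb{R})$ onto the Hardy space $\mathcal{H}^2=\mathfrak{L}(L^2(0,\infty))$. For $y\in X'$ and $x\in X$ put $$\mathfrak{D}_{g,y}x=M_g\big(\langle y,T(\cdot)x\rangle\big)\in L^2(0,\infty).$$ Let $g\in\mathcal{H}^\infty_-$. There is a unique linear operator $g(A):D(A)\to X$, bounded with respect to the graph norm of $A$, such that $\langle y,g(A)T(\cdot)x_1\rangle=\mathfrak{D}_{g,y}x_1$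 in $L^2(0,\infty)$ for all $y\in X'$ and $x_1\in D(A)$. Let $g_\Lambda(A)$ be its Lambda extension, $$g_\Lambda(A)x=\lim_{\lambda\to\infty}\lambda\, g(A)(\lambda I-A)^{-1}x \qquad(\lambda\text{ real}),$$ whose domain $D(g_\Lambda(A))$ consists of all $x\in X$ for which this limit exists in $X$. Then, for every $y\in X'$ and every $x\in D(g_\Lambda(A))$, one has $T(t)x\in D(g_\Lambda(A))$ for all $t\ge0$, and $$\langle y,g_\Lambda(A)T(\cdot)x\rangle=\mathfrak{D}_{g,y}x\qquad\text{in }L^2(0,\infty).$$ -/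

import Mathlib

open MeasureTheory Filter Set Topology
open scoped NNReal ENNReal FourierTransform

noncomputable section

namespace WeakCalculus

/-! ## Hardy space on the right half-plane and Toeplitz operators on `L²(0,∞)` -/

/-- `L²(0,∞)`. -/
abbrev L2Pos : Type := Lp ℂ 2 (volume.restrict (Ioi (0 : ℝ)))

/-- `L²(ℝ)`; it also plays the role of `L²(iℝ)`, where `ξ : ℝ` parametrizes the point
`2πiξ` of the imaginary axis. -/
abbrev L2Line : Type := Lp ℂ 2 (volume : Measure ℝ)

/-- Bounded holomorphic functions on the open left half-plane (values elsewhere are irrelevant). -/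
def IsHInfMinus (g : ℂ → ℂ) : Prop :=
  DifferentiableOn ℂ g {z : ℂ | z.re < 0} ∧ ∃ K : ℝ, ∀ z : ℂ, z.re < 0 → ‖g z‖ ≤ K

theorem memLp_zeroExt (f : L2Pos) :
    MemLp (indicator (Ioi (0 : ℝ)) f) 2 (volume : Measure ℝ) :=
  (memLp_indicator_iff_restrict measurableSet_Ioi).2 (Lp.memLp f)

/-- Extension by zero `L²(0,∞) → L²(ℝ)`. -/
def zeroExt : L2Pos →ₗᵢ[ℂ] L2Line where
  toFun f := (memLp_zeroExt f).toLp _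
  map_add' f₁ f₂ := by
    rw [← MemLp.toLp_add, MemLp.toLp_eq_toLp_iff, ← indicator_add']
    filter_upwards [(ae_restrict_iff' measurableSet_Ioi).1 (Lp.coeFn_add f₁ f₂)] with t ht
    by_cases h : t ∈ Ioi (0 : ℝ)
    · simpa [indicator_of_mem h] using ht h
    · simp [indicator_of_notMem h]
  map_smul' c f := by
    rw [RingHom.id_apply, ← MemLp.toLp_const_smul, MemLp.toLp_eq_toLp_iff]
    filter_upwards [(ae_restrict_iff' measurableSet_Ioi).1 (Lp.coeFn_smul c f)] with t ht
    by_cases h : t ∈ Ioi (0 : ℝ)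
    · simpa [indicator_of_mem h] using ht h
    · simp [indicator_of_notMem h]
  norm_map' f := by
    change ‖(memLp_zeroExt f).toLp _‖ = ‖f‖
    rw [Lp.norm_toLp, Lp.norm_def, eLpNorm_indicator_eq_eLpNorm_restrict measurableSet_Ioi]

/-- The Laplace transform of `f ∈ L²(0,∞)`, as a function on the imaginary axis:
`ξ ↦ ∫₀^∞ f(t) e^{-2πiξt} dt`, understood through Plancherel's theorem. -/
def laplace : L2Pos →ₗᵢ[ℂ] L2Line :=
  (Lp.fourierTransformₗᵢ ℝ ℂ).toLinearIsometry.comp zeroExt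

/-- The Hardy space `H²` of the right half-plane (boundary functions on the imaginary axis):
the space of Laplace transforms of elements of `L²(0,∞)`. -/
def hardy : Submodule ℂ L2Line := LinearMap.range laplace.toLinearMap

instance : CompleteSpace hardy :=
  (laplace.isometry.isUniformInducing.isComplete_range).completeSpace_coe

/-- The Laplace transform as an isometric isomorphism of `L²(0,∞)` onto `H²`. -/
def laplaceEquiv : L2Pos ≃ₗᵢ[ℂ] hardy := laplace.equivRange

/-- The boundary function on the imaginary axis of a function on the left half-plane, at `2πiξ`.
For a bounded holomorphic function the limit exists for almost every `ξ`. -/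
def boundary (g : ℂ → ℂ) (ξ : ℝ) : ℂ :=
  limUnder (𝓝[<] (0 : ℝ)) fun σ : ℝ => g ((σ : ℂ) + 2 * Real.pi * ξ * Complex.I)

open Classical in
/-- Multiplication `φ ↦ g · φ` on `L²(iℝ)`. For `g` bounded and holomorphic on the left
half-plane, the boundary function is measurable and essentially bounded, so the first case
always applies. -/
def boundaryMul (g : ℂ → ℂ) (φ : L2Line) : L2Line :=
  if h : MemLp (fun ξ : ℝ => boundary g ξ * φ ξ) 2 (volume : Measure ℝ) then h.toLp _ else 0

/-- The Toeplitz operator `M_g f = 𝔏⁻¹ Π (g · 𝔏 f)`, where `Π` is the orthogonal projection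
of `L²(iℝ)` onto `H²`. -/
def toeplitz (g : ℂ → ℂ) (f : L2Pos) : L2Pos :=
  laplaceEquiv.symm (hardy.orthogonalProjectionOnto (boundaryMul g (laplace f)))

variable {X : Type*} [NormedAddCommGroup X] [NormedSpace ℂ X]

/-! ## Resolvents and Lambda extensions -/

/-- The operator `λ - A : D(A) → X`. -/
def shift (A : X →ₗ.[ℂ] X) (l : ℂ) : A.domain →ₗ[ℂ] X := l • A.domain.subtype - A.toFun

open Classical in
/-- The resolvent `R(λ,A) = (λ - A)⁻¹ : X → D(A)` (junk value `0` if `λ - A` is not bijective). -/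
def resolv (A : X →ₗ.[ℂ] X) (l : ℂ) : X →ₗ[ℂ] A.domain :=
  if h : Function.Bijective (shift A l) then (LinearEquiv.ofBijective (shift A l) h).symm else 0

/-- The net `λ C R(λ,A) x`, `λ` real. -/
def lambdaNet (A : X →ₗ.[ℂ] X) (C : A.domain →ₗ[ℂ] X) (x : X) (l : ℝ) : X :=
  (l : ℂ) • C (resolv A l x)

/-- The Lambda extension `C_Λ x = lim_{λ → ∞} λ C R(λ,A) x` (limit along real `λ`),
defined on the set of all `x` for which the limit exists in `X`. -/
def lambdaExt (A : X →ₗ.[ℂ] X) (C : A.domain →ₗ[ℂ] X) : X →ₗ.[ℂ] X where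
  domain :=
    { carrier := {x | ∃ z, Tendsto (lambdaNet A C x) atTop (𝓝 z)}
      zero_mem' := ⟨0, tendsto_const_nhds.congr fun l => by simp [lambdaNet]⟩
      add_mem' := by
        rintro a b ⟨z, hz⟩ ⟨w, hw⟩
        refine ⟨z + w, (hz.add hw).congr fun l => ?_⟩
        simp [lambdaNet]
      smul_mem' := by
        rintro c a ⟨z, hz⟩
        refine ⟨c • z, (hz.const_smul c).congr fun l => ?_⟩
        simp [lambdaNet, smul_comm c] }
  toFun :=
    { toFun := fun x => limUnder atTop (lambdaNet A C x)
      map_add' := by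
        rintro ⟨a, z, hz⟩ ⟨b, w, hw⟩
        refine Eq.trans (Tendsto.limUnder_eq (x := z + w)
          ((hz.add hw).congr fun l => ?_)) (by rw [hz.limUnder_eq, hw.limUnder_eq])
        simp [lambdaNet]
      map_smul' := by
        rintro c ⟨a, z, hz⟩
        refine Eq.trans (Tendsto.limUnder_eq (x := c • z)
          ((hz.const_smul c).congr fun l => ?_)) (by rw [hz.limUnder_eq]; rfl)
        simp [lambdaNet, smul_comm c] }

/-! ## Semigroups -/

variable (X) in
/-- A `C₀`-semigroup of bounded operators on `X`. -/
structure C0Semigroup where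
  /-- The operators `T(t)`, `t ≥ 0`. -/
  op : ℝ≥0 → X →L[ℂ] X
  op_zero : op 0 = ContinuousLinearMap.id ℂ X
  op_add : ∀ s t, op (s + t) = (op s).comp (op t)
  continuous_orbit : ∀ x, Continuous fun t => op t x

namespace C0Semigroup

variable (T : C0Semigroup X)

/-- Exponential stability: the growth bound is negative. -/
def IsExpStable : Prop :=
  ∃ M ω : ℝ, ω < 0 ∧ ∀ t : ℝ≥0, ‖T.op t‖ ≤ M * Real.exp (ω * t)

/-- The difference quotient `(T(h)x - x) / h`. -/
def quot (x : X) (h : ℝ≥0) : X := ((h : ℝ) : ℂ)⁻¹ • (T.op h x - x)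

/-- The generator `A x = lim_{h ↓ 0} (T(h)x - x) / h`, defined on the set of all `x` for which the
limit exists. -/
def generator : X →ₗ.[ℂ] X where
  domain :=
    { carrier := {x | ∃ z, Tendsto (T.quot x) (𝓝[>] 0) (𝓝 z)}
      zero_mem' := ⟨0, tendsto_const_nhds.congr fun l => by simp [quot]⟩
      add_mem' := by
        rintro a b ⟨z, hz⟩ ⟨w, hw⟩
        refine ⟨z + w, (hz.add hw).congr fun l => ?_⟩
        simp [quot, smul_sub]; abel
      smul_mem' := by
        rintro c a ⟨z, hz⟩
        refine ⟨c • z, (hz.const_smul c).congr fun l => ?_⟩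
        simp only [quot, map_smul, ← smul_sub]; rw [smul_comm] }
  toFun :=
    { toFun := fun x => limUnder (𝓝[>] 0) (T.quot x)
      map_add' := by
        rintro ⟨a, z, hz⟩ ⟨b, w, hw⟩
        refine Eq.trans (Tendsto.limUnder_eq (x := z + w)
          ((hz.add hw).congr fun l => ?_)) (by rw [hz.limUnder_eq, hw.limUnder_eq])
        simp [quot, smul_sub]; abel
      map_smul' := by
        rintro c ⟨a, z, hz⟩
        refine Eq.trans (Tendsto.limUnder_eq (x := c • z)
          ((hz.const_smul c).congr fun l => ?_)) (by rw [hz.limUnder_eq]; rfl)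
        change _ = T.quot (c • a) l
        simp only [quot, map_smul, ← smul_sub]; rw [smul_comm] }

theorem op_mem_domain (t : ℝ≥0) {x : X} (hx : x ∈ T.generator.domain) :
    T.op t x ∈ T.generator.domain := by
  obtain ⟨z, hz⟩ := hx
  refine ⟨T.op t z, (((T.op t).continuous.tendsto z).comp hz).congr fun h => ?_⟩
  have e : T.op h (T.op t x) = T.op t (T.op h x) := by
    rw [← ContinuousLinearMap.comp_apply, ← ContinuousLinearMap.comp_apply, ← T.op_add,
      ← T.op_add, add_comm]
  simp [quot, e]

variable {T}

theorem IsExpStable.memLp_orbit (hT : T.IsExpStable) (y : StrongDual ℂ X) (x : X) :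
    MemLp (fun t : ℝ => y (T.op t.toNNReal x)) 2 (volume.restrict (Ioi (0 : ℝ))) := by
  obtain ⟨M, ω, hω, hM⟩ := hT
  have hc : Continuous fun t : ℝ => y (T.op t.toNNReal x) :=
    y.continuous.comp ((T.continuous_orbit x).comp continuous_real_toNNReal)
  have hexp : MemLp (fun t : ℝ => (‖y‖ * M * ‖x‖) * Real.exp (ω * t)) 2
      (volume.restrict (Ioi (0 : ℝ))) := by
    refine MemLp.const_mul ?_ _
    rw [memLp_two_iff_integrable_sq (by fun_prop)]
    have := integrableOn_exp_mul_Ioi (a := 2 * ω) (by linarith) 0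
    refine this.congr (ae_of_all _ fun t => ?_)
    simp only [← Real.exp_nat_mul]
    congr 1; push_cast; ring
  refine hexp.mono' hc.aestronglyMeasurable ?_
  filter_upwards [ae_restrict_mem measurableSet_Ioi] with t ht
  have h1 := hM t.toNNReal
  rw [Real.coe_toNNReal t (le_of_lt ht)] at h1
  calc ‖y (T.op t.toNNReal x)‖ ≤ ‖y‖ * (‖T.op t.toNNReal‖ * ‖x‖) :=
        (y.le_opNorm _).trans (by gcongr; exact (T.op _).le_opNorm x)
    _ ≤ ‖y‖ * (M * Real.exp (ω * t) * ‖x‖) := by gcongr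
    _ = (‖y‖ * M * ‖x‖) * Real.exp (ω * t) := by ring

/-- The element `⟨y, T(·)x⟩` of `L²(0,∞)`. -/
def weakOrbit (hT : T.IsExpStable) (y : StrongDual ℂ X) (x : X) : L2Pos :=
  (hT.memLp_orbit y x).toLp _

/-- The output mapping `𝔇_{g,y} x = M_g ⟨y, T(·)x⟩`. -/
def outputMap (hT : T.IsExpStable) (g : ℂ → ℂ) (y : StrongDual ℂ X) (x : X) : L2Pos :=
  toeplitz g (weakOrbit hT y x)

/-- The property that characterizes `g(A)`: `C : D(A) → X` is linear, bounded with respect to the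
graph norm of `A`, and `⟨y, C T(·)x₁⟩ = 𝔇_{g,y} x₁` in `L²(0,∞)` for all `y ∈ X'`, `x₁ ∈ D(A)`. -/
def IsCalculusOp (hT : T.IsExpStable) (g : ℂ → ℂ) (C : T.generator.domain →ₗ[ℂ] X) : Prop :=
  (∃ K : ℝ, ∀ u : T.generator.domain, ‖C u‖ ≤ K * (‖(u : X)‖ + ‖T.generator u‖)) ∧
  ∀ (y : StrongDual ℂ X) (u : T.generator.domain),
    ∀ᵐ t : ℝ ∂(volume.restrict (Ioi (0 : ℝ))),
      y (C ⟨T.op t.toNNReal u, T.op_mem_domain t.toNNReal u.2⟩) = (outputMap hT g y (u : X) : ℝ → ℂ) t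

open Classical in
/-- The operator `g(A) : D(A) → X`. -/
def calculusOp (hT : T.IsExpStable) (g : ℂ → ℂ) : T.generator.domain →ₗ[ℂ] X :=
  if h : ∃ C, IsCalculusOp hT g C then h.choose else 0

/-- The Lambda extension `g_Λ(A)` of `g(A)`. -/
def calculusLambda (hT : T.IsExpStable) (g : ℂ → ℂ) : X →ₗ.[ℂ] X :=
  lambdaExt T.generator (calculusOp hT g)

end C0Semigroup

end WeakCalculus

end

noncomputable section

namespace WeakCalculus

open Complex (I)

/-! ## Cauchy's theorem on a half-plane -/

/-! The exponentials `e_l(t) = e^{-lt}`, `Re l > 0`, are total in `L²(0,∞)` and diagonalize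
everything: the left shift `S_t` multiplies `e_l` by `e^{-lt}`, and `M_g e_l = g(-l) e_l`, by
Cauchy's formula on the left half-plane. Since the symbol is a pointwise boundary limit, this needs
Fatou's theorem (`ae_tendsto_boundary`).

Put `r(z) = (1 - z)⁻¹`. Testing on exponentials gives `(M_g M_r v)(t) = ⟨e_1, M_g S_t v⟩` for almost
every `t` (`toeplitz_resolvent_ae_eq`). By Riesz, `v ↦ ⟨e_1, M_g v⟩` is integration against some `k
∈ L²(0,∞)`. Exponential stability makes `‖T(·)‖` square integrable, so `g(A)u = ∫ k(t) T(t)(1 - A)u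
dt` converges in `X` itself, not merely in the bidual. For `v = ⟨y, T(·)(1 - A)u⟩` one has `S_t v =
⟨y, T(·)T(t)(1 - A)u⟩` and `M_r v = ⟨y, T(·)u⟩`, so the correlation identity is exactly the
characterization of `g(A)`. Uniqueness follows from continuity in the graph norm, evaluated at `t =
0`.

The operator `g(A)` commutes with `T(t)`, so `𝔇_{g,y} u = ⟨y, T(·)g(A)u⟩` for `u ∈ D(A)`. Taking `u
= λR(λ,A)x → x`, with `g(A)u → z = g_Λ(A)x`, and using continuity of both sides into `L²` gives
`𝔇_{g,y} x = ⟨y, T(·)z⟩`. Commutation also gives `g_Λ(A)T(t)x = T(t)z`. -/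

theorem integrable_of_continuous_of_le_div_sq {f : ℝ → ℂ} (hf : Continuous f) {C R : ℝ}
    (h : ∀ y, R ≤ |y| → ‖f y‖ ≤ C / y ^ 2) : Integrable f := by
  refine hf.locallyIntegrable.integrable_of_isBigO_cocompact (g := fun y : ℝ => (1 + y ^ 2)⁻¹) ?_
    (integrable_inv_one_add_sq.integrableAtFilter _)
  refine Asymptotics.IsBigO.of_bound (2 * C) ?_
  have hev : ∀ᶠ y : ℝ in cocompact ℝ, max R 1 ≤ |y| :=
    (tendsto_norm_cocompact_atTop (E := ℝ)).eventually (eventually_ge_atTop _)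
  filter_upwards [hev] with y hy
  have h1 : 1 ≤ |y| := (le_max_right _ _).trans hy
  have hy2 : 1 ≤ y ^ 2 := by rw [← sq_abs]; exact one_le_pow₀ h1
  have hC : 0 ≤ C := by
    have := (norm_nonneg _).trans (h y ((le_max_left _ _).trans hy))
    by_contra hc
    exact absurd this (not_le.2 (div_neg_of_neg_of_pos (not_le.1 hc) (by linarith)))
  refine (h y ((le_max_left _ _).trans hy)).trans ?_
  rw [Real.norm_of_nonneg (by positivity), ← div_eq_mul_inv, div_le_div_iff₀ (by linarith)
    (by linarith)]
  nlinarith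

/-- Cauchy's theorem on the rectangle `[-r,0] × [-r,r]`: the three sides off the imaginary axis have
total length `4r` and carry values of size at most `C / r²`. -/
theorem integral_line_eq_zero {F : ℂ → ℂ} (hF : DifferentiableOn ℂ F {z | z.re ≤ 0}) {C R : ℝ}
    (h : ∀ z : ℂ, z.re ≤ 0 → R ≤ ‖z‖ → ‖F z‖ ≤ C / ‖z‖ ^ 2) :
    ∫ y : ℝ, F (y * I) = 0 := by
  have hcont : Continuous fun y : ℝ => F (y * I) :=
    hF.continuousOn.comp_continuous (by fun_prop) (by simp)
  have hint : Integrable fun y : ℝ => F (y * I) :=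
    integrable_of_continuous_of_le_div_sq hcont (C := C) (R := R) fun y hy => by
      simpa using h (y * I) (by simp) (by simpa using hy)
  have h1 := intervalIntegral_tendsto_integral hint tendsto_neg_atTop_atBot tendsto_id
  refine tendsto_nhds_unique h1 (squeeze_zero_norm' (a := fun r : ℝ => 4 * C / r) ?_
    (tendsto_const_nhds.div_atTop tendsto_id))
  filter_upwards [eventually_ge_atTop (max R 1)] with r hr
  have hr0 : 0 < r := by linarith [(le_max_right _ _).trans hr]
  have hRr : R ≤ r := (le_max_left _ _).trans hr
  have key := Complex.integral_boundary_rect_eq_zero_of_differentiableOn F (-r - r * I) (r * I)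
    (hF.mono fun z hz => by
      have := hz.1
      simp only [mem_preimage, Complex.sub_re, Complex.neg_re, Complex.ofReal_re, Complex.mul_re,
        Complex.I_re, Complex.ofReal_im, Complex.I_im] at this
      rw [uIcc_of_le (by simpa using hr0.le)] at this
      simpa using this.2)
  have bd : ∀ z : ℂ, z.re ≤ 0 → r ≤ ‖z‖ → ‖F z‖ ≤ C / r ^ 2 := fun z hz hrz => by
    have h0 := h z hz (hRr.trans hrz)
    have hC : 0 ≤ C := by
      by_contra hc
      exact absurd ((norm_nonneg _).trans h0)
        (not_le.2 (div_neg_of_neg_of_pos (not_le.1 hc) (pow_pos (hr0.trans_le hrz) 2)))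
    exact h0.trans (by gcongr)
  have bH : ∀ s : ℝ, |s| = r → ‖∫ x in (-r)..0, F (x + s * I)‖ ≤ C / r := fun s hs => by
    refine (intervalIntegral.norm_integral_le_of_norm_le_const (C := C / r ^ 2)
      fun x hx => bd _ ?_ ?_).trans (le_of_eq ?_)
    · rw [uIoc_of_le (by linarith)] at hx; simpa using hx.2
    · rw [← hs]; simpa using Complex.abs_im_le_norm (x + s * I)
    · simp [abs_of_pos hr0]; field_simp
  have bV : ‖∫ y in (-r)..r, F (-r + y * I)‖ ≤ 2 * C / r := by
    refine (intervalIntegral.norm_integral_le_of_norm_le_const (C := C / r ^ 2)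
      fun x hx => bd _ ?_ ?_).trans (le_of_eq ?_)
    · simpa using hr0.le
    · simpa [abs_of_pos hr0] using Complex.abs_re_le_norm (-r + x * I)
    · rw [sub_neg_eq_add, abs_of_pos (by linarith)]; field_simp; ring
  simp only [Complex.sub_re, Complex.neg_re, Complex.ofReal_re, Complex.mul_re, Complex.I_re,
    Complex.ofReal_im, Complex.I_im, Complex.sub_im, Complex.neg_im, Complex.mul_im, mul_zero,
    mul_one, sub_self, sub_zero, neg_zero, zero_add, add_zero, zero_sub, Complex.ofReal_zero,
    Complex.ofReal_neg] at key
  have b1 := bH r (abs_of_pos hr0)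
  have b2 := bH (-r) (by rw [abs_neg, abs_of_pos hr0])
  rw [Complex.ofReal_neg] at b2
  set a := ∫ x in (-r)..0, F (x + r * I)
  set b := ∫ x in (-r)..0, F (x + -r * I)
  set c := ∫ y in (-r)..r, F (-r + y * I)
  change ‖∫ y in (-r)..r, F (y * I)‖ ≤ 4 * C / r
  set d := ∫ y in (-r)..r, F (y * I)
  have hd : I * d = a - b + I * c := by
    simp only [smul_eq_mul] at key; linear_combination key
  calc ‖d‖ = ‖I * d‖ := by simp
    _ ≤ ‖a‖ + ‖b‖ + ‖I * c‖ := by rw [hd]; exact (norm_add_le _ _).trans (by gcongr; exact norm_sub_le _ _)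
    _ ≤ C / r + C / r + 2 * C / r := by
      rw [norm_mul, Complex.norm_I, one_mul]; gcongr
    _ = 4 * C / r := by ring

theorem half_norm_le_norm_add {z l : ℂ} (h : 2 * ‖l‖ ≤ ‖z‖) : ‖z‖ / 2 ≤ ‖z + l‖ := by
  have := norm_sub_le (z + l) l
  rw [add_sub_cancel_right] at this
  linarith

theorem add_ne_zero_of_re_pos {l : ℂ} (hl : 0 < l.re) (y : ℝ) : (y * I + l : ℂ) ≠ 0 :=
  fun h => hl.ne' (by simpa using congrArg Complex.re h)

theorem sub_ne_zero_of_re_pos {m : ℂ} (hm : 0 < m.re) (y : ℝ) : (m - y * I : ℂ) ≠ 0 :=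
  fun h => hm.ne' (by simpa using congrArg Complex.re h)

/-- The product of two Cauchy kernels with poles `-l` and `m` on the imaginary axis. -/
def pairKernel (l m : ℂ) (y : ℝ) : ℂ := ((y * I + l) * (m - y * I))⁻¹

theorem continuous_pairKernel {l m : ℂ} (hl : 0 < l.re) (hm : 0 < m.re) :
    Continuous (pairKernel l m) :=
  Continuous.inv₀ (by fun_prop) fun y =>
    mul_ne_zero (add_ne_zero_of_re_pos hl y) (sub_ne_zero_of_re_pos hm y)

theorem norm_inv_mul_le {l m z : ℂ} (h1 : 2 * ‖l‖ + 2 * ‖m‖ + 1 ≤ ‖z‖) :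
    ‖((z + l) * (m - z))⁻¹‖ ≤ 4 / ‖z‖ ^ 2 := by
  have hz : 0 < ‖z‖ := by linarith [norm_nonneg l, norm_nonneg m]
  have a1 := half_norm_le_norm_add (z := z) (l := l) (by linarith [norm_nonneg m])
  have a2 := half_norm_le_norm_add (z := z) (l := -m) (by rw [norm_neg]; linarith [norm_nonneg l])
  rw [← sub_eq_add_neg, norm_sub_rev] at a2
  rw [norm_inv, norm_mul]
  calc (‖z + l‖ * ‖m - z‖)⁻¹ ≤ (‖z‖ / 2 * (‖z‖ / 2))⁻¹ := by gcongr
    _ = 4 / ‖z‖ ^ 2 := by field_simp; norm_num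

theorem integrable_pairKernel {l m : ℂ} (hl : 0 < l.re) (hm : 0 < m.re) :
    Integrable (pairKernel l m) :=
  integrable_of_continuous_of_le_div_sq (continuous_pairKernel hl hm) fun y hy => by
    simpa [pairKernel] using norm_inv_mul_le (l := l) (m := m) (z := y * I) (by simpa using hy)

/-- Cauchy's formula on the left half-plane, against a product of two Cauchy kernels. -/
theorem integral_mul_pairKernel {g : ℂ → ℂ} (hg : DifferentiableOn ℂ g {z | z.re ≤ 0}) {K : ℝ}
    (hK : ∀ z : ℂ, z.re ≤ 0 → ‖g z‖ ≤ K) {l m : ℂ} (hl : 0 < l.re) (hm : 0 < m.re) :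
    ∫ y : ℝ, g (y * I) * pairKernel l m y = g (-l) * ∫ y : ℝ, pairKernel l m y := by
  have hnhds : {z : ℂ | z.re ≤ 0} ∈ 𝓝 (-l) :=
    mem_of_superset ((isOpen_lt Complex.continuous_re continuous_const).mem_nhds
      (show (-l).re < 0 by simpa using hl)) fun z (hz : z.re < 0) => hz.le
  have hne : ∀ z : ℂ, z.re ≤ 0 → m - z ≠ 0 := fun z hz h => by
    have := congrArg Complex.re h
    simp at this; linarith
  have hK0 : 0 ≤ K := (norm_nonneg _).trans (hK 0 (by simp))
  -- The divided difference removes the pole at `-l`, so the integrand extends holomorphically to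
  -- the closed half-plane, with quadratic decay because `g` is bounded.
  have h0 : ∫ y : ℝ, dslope g (-l) (y * I) * (m - y * I)⁻¹ = 0 := by
    refine integral_line_eq_zero (F := fun z => dslope g (-l) z * (m - z)⁻¹) (C := 8 * K)
      (R := 2 * ‖l‖ + 2 * ‖m‖ + 1) ?_ fun z hz hR => ?_
    · exact ((Complex.differentiableOn_dslope hnhds).2 hg).mul
        ((differentiableOn_const m).sub differentiableOn_id |>.inv hne)
    · have hzl : z ≠ -l := by
        rintro rfl
        rw [norm_neg] at hR; linarith [norm_nonneg l, norm_nonneg m]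
      have e : dslope g (-l) z * (m - z)⁻¹ = (g z - g (-l)) * ((z + l) * (m - z))⁻¹ := by
        rw [dslope_of_ne _ hzl, slope_def_field, sub_neg_eq_add, mul_inv]; ring
      rw [e, norm_mul]
      calc ‖g z - g (-l)‖ * ‖((z + l) * (m - z))⁻¹‖ ≤ (K + K) * (4 / ‖z‖ ^ 2) := by
            gcongr
            · exact (norm_sub_le _ _).trans (add_le_add (hK z hz) (hK _ (by simpa using hl.le)))
            · exact norm_inv_mul_le hR
        _ = 8 * K / ‖z‖ ^ 2 := by ring
  have e : ∀ y : ℝ, dslope g (-l) (y * I) * (m - y * I)⁻¹ =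
      g (y * I) * pairKernel l m y - g (-l) * pairKernel l m y := fun y => by
    have hzl : (y * I : ℂ) ≠ -l := fun h => add_ne_zero_of_re_pos hl y (by rw [h]; simp)
    rw [dslope_of_ne _ hzl, slope_def_field, sub_neg_eq_add, pairKernel, mul_inv]; ring
  simp only [e] at h0
  have hgc : Continuous fun y : ℝ => g (y * I) :=
    hg.continuousOn.comp_continuous (by fun_prop) (by simp)
  rw [integral_sub ((integrable_pairKernel hl hm).bdd_mul hgc.aestronglyMeasurable
    (ae_of_all _ fun y => hK _ (by simp))) ((integrable_pairKernel hl hm).const_mul _),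
    integral_const_mul] at h0
  exact sub_eq_zero.1 h0

end WeakCalculus
end

noncomputable section

namespace WeakCalculus

open Complex (I)

/-! ## Boundary limits of bounded holomorphic functions (Fatou's theorem) -/

/-- A single integrable majorant, independent of scale, for all the dominated convergence arguments
in Fatou's theorem. -/
theorem norm_mul_poissonDeriv_le {K : ℝ} (hK : 0 ≤ K) {a : ℂ} {w : ℝ} (ha : ‖a‖ ≤ K * |w|) :
    ‖a * (2 * w / (1 + w ^ 2) ^ 2 : ℝ)‖ ≤ 2 * K * (1 + w ^ 2)⁻¹ := by
  have hpos : 0 < 1 + w ^ 2 := by positivity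
  simp only [norm_mul, Complex.norm_real, Real.norm_eq_abs, abs_div, abs_mul, abs_two]
  rw [abs_of_pos (pow_pos hpos 2)]
  calc ‖a‖ * (2 * |w| / (1 + w ^ 2) ^ 2) ≤ K * |w| * (2 * |w| / (1 + w ^ 2) ^ 2) := by gcongr
    _ = 2 * K * (w ^ 2 / (1 + w ^ 2) ^ 2) := by rw [← sq_abs w]; ring
    _ ≤ 2 * K * (1 + w ^ 2)⁻¹ := by
      gcongr
      rw [div_le_iff₀ (pow_pos hpos 2), pow_two (1 + w ^ 2), inv_mul_cancel_left₀ hpos.ne']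
      linarith

/-- Integration by parts moves the derivative onto the Poisson kernel. Only the primitive of `h`
remains, and primitives of `g` on vertical lines have limits at every boundary point. -/
theorem integral_div_one_add_sq_eq {h : ℝ → ℂ} (hc : Continuous h) {K : ℝ} (hK : ∀ w, ‖h w‖ ≤ K) :
    ∫ w : ℝ, h w * ((1 + w ^ 2)⁻¹ : ℝ) =
      ∫ w : ℝ, (∫ t in (0 : ℝ)..w, h t) * (2 * w / (1 + w ^ 2) ^ 2 : ℝ) := by
  set u : ℝ → ℂ := fun w => ∫ t in (0 : ℝ)..w, h t with hu
  have hu' : ∀ w, HasDerivAt u (h w) w := fun w =>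
    intervalIntegral.integral_hasDerivAt_right (hc.intervalIntegrable _ _)
      hc.aestronglyMeasurable.stronglyMeasurableAtFilter hc.continuousAt
  have hub : ∀ w, ‖u w‖ ≤ K * |w| := fun w => by
    simpa using intervalIntegral.norm_integral_le_of_norm_le_const (a := 0) (b := w) (C := K)
      fun t _ => hK t
  have huc : Continuous u := continuous_iff_continuousAt.2 fun w => (hu' w).continuousAt
  have hK0 : 0 ≤ K := (norm_nonneg _).trans (hK 0)
  have hpos : ∀ w : ℝ, 0 < 1 + w ^ 2 := fun w => by positivity
  have hv' : ∀ w : ℝ, HasDerivAt (fun w : ℝ => (((1 + w ^ 2)⁻¹ : ℝ) : ℂ))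
      ((-(2 * w) / (1 + w ^ 2) ^ 2 : ℝ) : ℂ) w := fun w => by
    refine HasDerivAt.ofReal_comp ?_
    have := (((hasDerivAt_id w).pow 2).const_add 1).inv (hpos w).ne'
    simpa [Pi.inv_def] using this
  have hvc : Continuous fun w : ℝ => (((1 + w ^ 2)⁻¹ : ℝ) : ℂ) :=
    continuous_iff_continuousAt.2 fun w => (hv' w).continuousAt
  have hvc' : Continuous fun w : ℝ => ((-(2 * w) / (1 + w ^ 2) ^ 2 : ℝ) : ℂ) :=
    Complex.continuous_ofReal.comp (Continuous.div (by fun_prop) (by fun_prop) fun w =>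
      (pow_pos (hpos w) 2).ne')
  have hint : Integrable (u * fun w : ℝ => ((-(2 * w) / (1 + w ^ 2) ^ 2 : ℝ) : ℂ)) := by
    refine (integrable_inv_one_add_sq.const_mul (2 * K)).mono'
      (huc.mul hvc').aestronglyMeasurable (ae_of_all _ fun w => ?_)
    have e : (u * fun w : ℝ => ((-(2 * w) / (1 + w ^ 2) ^ 2 : ℝ) : ℂ)) w =
        -(u w * (2 * w / (1 + w ^ 2) ^ 2 : ℝ)) := by
      simp only [Pi.mul_apply]; push_cast; ring
    rw [e, norm_neg]
    exact norm_mul_poissonDeriv_le hK0 (hub w)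
  have hint2 : Integrable (h * fun w : ℝ => (((1 + w ^ 2)⁻¹ : ℝ) : ℂ)) :=
    (integrable_inv_one_add_sq.ofReal (𝕜 := ℂ)).bdd_mul hc.aestronglyMeasurable
      (ae_of_all _ hK)
  have hlim : Tendsto (u * fun w : ℝ => (((1 + w ^ 2)⁻¹ : ℝ) : ℂ)) (cocompact ℝ) (𝓝 0) := by
    refine squeeze_zero_norm' (a := fun w : ℝ => K / ‖w‖) ?_
      (tendsto_const_nhds.div_atTop tendsto_norm_cocompact_atTop)
    filter_upwards [(tendsto_norm_cocompact_atTop (E := ℝ)).eventually (eventually_gt_atTop 0)]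
      with w hw
    rw [Real.norm_eq_abs] at hw
    simp only [Pi.mul_apply, norm_mul, Complex.norm_real, Real.norm_eq_abs]
    rw [abs_of_pos (inv_pos.2 (hpos w))]
    calc ‖u w‖ * (1 + w ^ 2)⁻¹ ≤ K * |w| * (|w| * |w|)⁻¹ := by
          gcongr
          · exact hub w
          · rw [abs_mul_abs_self]; nlinarith
      _ = K / |w| := by field_simp
  rw [cocompact_eq_atBot_atTop] at hlim
  have := integral_mul_deriv_eq_deriv_mul (fun w _ => hu' w) (fun w _ => hv' w) hint hint2
    (hlim.mono_left le_sup_left) (hlim.mono_left le_sup_right)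
  rw [sub_self, zero_sub] at this
  rw [← neg_inj, ← this, ← integral_neg]
  exact integral_congr_ae (ae_of_all _ fun w => by push_cast; ring)

/-- The primitive of a function along a vertical line. -/
def vertPrimitive (g : ℂ → ℂ) (σ y : ℝ) : ℂ := ∫ t in (0 : ℝ)..y, g (σ + t * I)

section

variable {g : ℂ → ℂ} (hg : DifferentiableOn ℂ g {z : ℂ | z.re < 0}) {K : ℝ}
  (hK : ∀ z : ℂ, z.re < 0 → ‖g z‖ ≤ K)
include hg

theorem continuous_vertical {σ : ℝ} (hσ : σ < 0) (a b : ℝ) :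
    Continuous fun t : ℝ => g (σ + (a + b * t : ℝ) * I) :=
  hg.continuousOn.comp_continuous (by fun_prop) fun t => by simpa using hσ

include hK

/-- By Cauchy's theorem on a rectangle the difference is carried by two horizontal sides of length
`|τ - σ|`. Hence the primitives are Cauchy as `σ ↑ 0`. -/
theorem norm_vertPrimitive_sub_le {σ τ : ℝ} (hσ : σ < 0) (hτ : τ < 0) (y : ℝ) :
    ‖vertPrimitive g τ y - vertPrimitive g σ y‖ ≤ 2 * K * |τ - σ| := by
  have key := Complex.integral_boundary_rect_eq_zero_of_differentiableOn g σ (τ + y * I)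
    (hg.mono fun z hz => by
      have := hz.1.2
      simp only [Complex.add_re, Complex.ofReal_re, Complex.mul_re, Complex.I_re,
        Complex.ofReal_im, Complex.I_im, mul_zero, mul_one, sub_self, add_zero] at this
      exact this.trans_lt (max_lt hσ hτ))
  simp only [Complex.add_re, Complex.ofReal_re, Complex.mul_re, Complex.I_re, Complex.add_im,
    Complex.mul_im, Complex.ofReal_im, Complex.I_im, mul_zero, mul_one, sub_self, add_zero,
    zero_add, smul_eq_mul, Complex.ofReal_zero, zero_mul] at key
  have bd : ∀ s : ℝ, ‖∫ x in σ..τ, g (x + s * I)‖ ≤ K * |τ - σ| := fun s =>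
    intervalIntegral.norm_integral_le_of_norm_le_const fun x hx => hK _ (by
      simpa using hx.2.trans_lt (max_lt hσ hτ))
  have b0 := bd 0
  simp only [Complex.ofReal_zero, zero_mul, add_zero] at b0
  have e : I * (vertPrimitive g τ y - vertPrimitive g σ y) =
      (∫ x in σ..τ, g (x + y * I)) - ∫ x in σ..τ, g x := by
    unfold vertPrimitive; linear_combination key
  calc _ = ‖I * (vertPrimitive g τ y - vertPrimitive g σ y)‖ := by simp
    _ ≤ K * |τ - σ| + K * |τ - σ| := by
      rw [e]; exact (norm_sub_le _ _).trans (add_le_add (bd y) b0)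
    _ = _ := by ring

theorem norm_vertPrimitive_sub_le' {σ : ℝ} (hσ : σ < 0) (x y : ℝ) :
    ‖vertPrimitive g σ y - vertPrimitive g σ x‖ ≤ K * |y - x| := by
  have hc : Continuous fun t : ℝ => g (σ + t * I) := by
    simpa using continuous_vertical hg hσ 0 1
  rw [vertPrimitive, vertPrimitive, intervalIntegral.integral_interval_sub_left
    (hc.intervalIntegrable _ _) (hc.intervalIntegrable _ _)]
  exact intervalIntegral.norm_integral_le_of_norm_le_const fun t _ => hK _ (by simpa using hσ)

/-- Bounded holomorphic functions have a Lipschitz primitive on the boundary line. -/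
theorem exists_boundary_primitive : ∃ Φ : ℝ → ℂ, (∀ x y, ‖Φ y - Φ x‖ ≤ K * |y - x|) ∧
    ∀ y, Tendsto (fun σ => vertPrimitive g σ y) (𝓝[<] 0) (𝓝 (Φ y)) := by
  have hlim : ∀ y, ∃ c, Tendsto (fun σ => vertPrimitive g σ y) (𝓝[<] 0) (𝓝 c) := fun y => by
    have hK0 : 0 ≤ K := (norm_nonneg _).trans (hK (-1) (by simp))
    refine cauchy_map_iff_exists_tendsto.1 (Metric.cauchy_iff.2 ⟨inferInstance, fun ε hε => ?_⟩)
    have hd : (0 : ℝ) < ε / (2 * K + 1) := by positivity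
    refine ⟨_, image_mem_map (Ioo_mem_nhdsLT (neg_lt_zero.2 hd)), ?_⟩
    rintro _ ⟨τ, hτ, rfl⟩ _ ⟨σ, hσ, rfl⟩
    rw [dist_eq_norm]
    refine (norm_vertPrimitive_sub_le hg hK hσ.2 hτ.2 y).trans_lt ?_
    have h1 : |τ - σ| < ε / (2 * K + 1) := by
      rw [abs_lt]; constructor <;> linarith [hτ.1, hτ.2, hσ.1, hσ.2]
    rw [lt_div_iff₀ (by positivity)] at h1
    nlinarith [abs_nonneg (τ - σ)]
  choose Φ hΦ using hlim
  refine ⟨Φ, fun x y => le_of_tendsto ((hΦ y).sub (hΦ x)).norm ?_, hΦ⟩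
  filter_upwards [self_mem_nhdsWithin] with σ hσ
  exact norm_vertPrimitive_sub_le' hg hK hσ x y

/-- The Poisson formula is Cauchy's formula with both kernel parameters equal to `1`, applied to the
rescaled function `z ↦ g(rz + σ + iy)`, whose value at `-1` is the left side; then integrate by
parts. The factor `π` is `∫ (1 + w²)⁻¹`. -/
theorem pi_mul_eq_integral_vertPrimitive {σ : ℝ} (hσ : σ < 0) {r : ℝ} (hr : 0 < r) (y : ℝ) :
    Real.pi * g ((σ - r : ℝ) + y * I) =
      ∫ w : ℝ, ((r⁻¹ : ℝ) * (vertPrimitive g σ (y + r * w) - vertPrimitive g σ y)) *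
        (2 * w / (1 + w ^ 2) ^ 2 : ℝ) := by
  set h : ℂ → ℂ := fun z => g (r * z + (σ + y * I)) with hh
  have hre : ∀ z : ℂ, z.re ≤ 0 → (r * z + (σ + y * I) : ℂ).re < 0 := fun z hz => by
    simp; nlinarith
  have hd : DifferentiableOn ℂ h {z | z.re ≤ 0} :=
    hg.comp (by fun_prop) fun z hz => hre z hz
  have h1 := integral_mul_pairKernel hd (K := K) (fun z hz => hK _ (hre z hz)) (l := 1) (m := 1)
    (by simp) (by simp)
  have hpk : ∀ w : ℝ, pairKernel 1 1 w = ((1 + w ^ 2)⁻¹ : ℝ) := fun w => by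
    rw [pairKernel]; push_cast; congr 1
    linear_combination (-(w : ℂ) ^ 2) * Complex.I_sq
  simp only [hpk] at h1
  rw [integral_complex_ofReal, integral_univ_inv_one_add_sq] at h1
  have hline : ∀ w : ℝ, h (w * I) = g (σ + (y + r * w : ℝ) * I) := fun w => by
    rw [hh]; dsimp only; congr 1; push_cast; ring
  simp only [hline] at h1
  rw [integral_div_one_add_sq_eq (continuous_vertical hg hσ y r) (K := K)
    (fun w => hK _ (by simpa using hσ))] at h1
  have hm1 : h (-1) = g ((σ - r : ℝ) + y * I) := by
    rw [hh]; dsimp only; congr 1; push_cast; ring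
  rw [hm1, mul_comm] at h1
  rw [← h1]
  refine integral_congr_ae (ae_of_all _ fun w => ?_)
  have hc : Continuous fun t : ℝ => g (σ + t * I) := by
    simpa using continuous_vertical hg hσ 0 1
  have := intervalIntegral.integral_comp_add_mul (fun t : ℝ => g (σ + t * I)) hr.ne' y
    (a := 0) (b := w)
  dsimp only
  rw [this, vertPrimitive, vertPrimitive, intervalIntegral.integral_interval_sub_left
    (hc.intervalIntegrable _ _) (hc.intervalIntegrable _ _), mul_zero, add_zero,
    Complex.real_smul]

/-- **Fatou's theorem** on the left half-plane: bounded holomorphic functions have normal limits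
at almost every boundary point. -/
theorem ae_exists_tendsto_boundary :
    ∀ᵐ y : ℝ, ∃ c, Tendsto (fun σ : ℝ => g (σ + y * I)) (𝓝[<] 0) (𝓝 c) := by
  obtain ⟨Φ, hΦ, hlim⟩ := exists_boundary_primitive hg hK
  have hK0 : 0 ≤ K := (norm_nonneg _).trans (hK (-1) (by simp))
  have hLip : LipschitzWith ⟨K, hK0⟩ Φ := LipschitzWith.of_dist_le_mul fun x y => by
    rw [dist_eq_norm, dist_eq_norm]; exact hΦ y x
  have hb : ∀ f : ℝ → ℂ, (∀ x y, ‖f y - f x‖ ≤ K * |y - x|) → ∀ r > 0, ∀ y w : ℝ,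
      ‖((r⁻¹ : ℝ) * (f (y + r * w) - f y)) * (2 * w / (1 + w ^ 2) ^ 2 : ℝ)‖ ≤
        2 * K * (1 + w ^ 2)⁻¹ := fun f hf r hr y w => by
    refine norm_mul_poissonDeriv_le hK0 ?_
    rw [norm_mul, Complex.norm_real, Real.norm_of_nonneg (inv_pos.2 hr).le]
    calc r⁻¹ * ‖f (y + r * w) - f y‖ ≤ r⁻¹ * (K * |y + r * w - y|) := by gcongr; exact hf _ _
      _ = K * |w| := by
        rw [add_sub_cancel_left, abs_mul, abs_of_pos hr]; field_simp
  have hm : ∀ f : ℝ → ℂ, Continuous f → ∀ r y : ℝ, AEStronglyMeasurable (fun w : ℝ =>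
      ((r⁻¹ : ℝ) * (f (y + r * w) - f y)) * (2 * w / (1 + w ^ 2) ^ 2 : ℝ)) := fun f hf r y => by
    refine Measurable.aestronglyMeasurable ?_
    have := hf.measurable
    fun_prop
  have hbi : Integrable fun w : ℝ => 2 * K * (1 + w ^ 2)⁻¹ :=
    integrable_inv_one_add_sq.const_mul _
  -- Letting `σ ↑ 0` in the Poisson formula expresses the interior values through the Lipschitz
  -- boundary primitive `Φ`.
  have hform : ∀ r > 0, ∀ y : ℝ, Real.pi * g ((-r : ℝ) + y * I) =
      ∫ w : ℝ, ((r⁻¹ : ℝ) * (Φ (y + r * w) - Φ y)) * (2 * w / (1 + w ^ 2) ^ 2 : ℝ) := by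
    intro r hr y
    have hcont : Tendsto (fun σ : ℝ => Real.pi * g ((σ - r : ℝ) + y * I)) (𝓝[<] 0)
        (𝓝 (Real.pi * g ((-r : ℝ) + y * I))) := by
      have hca : ContinuousAt (fun σ : ℝ => g ((σ - r : ℝ) + y * I)) 0 := by
        refine ContinuousAt.comp (g := g) ?_ (by fun_prop)
        exact (hg.differentiableAt ((isOpen_lt Complex.continuous_re continuous_const).mem_nhds
          (by simpa using hr))).continuousAt
      have := hca.tendsto.mono_left (nhdsWithin_le_nhds (s := Iio 0))
      rw [zero_sub] at this
      exact this.const_mul _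
    refine tendsto_nhds_unique hcont ?_
    refine Tendsto.congr' (f₁ := fun σ => ∫ w : ℝ,
      ((r⁻¹ : ℝ) * (vertPrimitive g σ (y + r * w) - vertPrimitive g σ y)) *
        (2 * w / (1 + w ^ 2) ^ 2 : ℝ)) ?_ ?_
    · filter_upwards [self_mem_nhdsWithin] with σ hσ
      exact (pi_mul_eq_integral_vertPrimitive hg hK hσ hr y).symm
    · refine tendsto_integral_filter_of_dominated_convergence _ ?_ ?_ hbi (ae_of_all _ fun w => ?_)
      · filter_upwards [self_mem_nhdsWithin] with σ hσ
        refine hm _ ?_ r y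
        have hLσ : LipschitzWith ⟨K, hK0⟩ (vertPrimitive g σ) :=
          LipschitzWith.of_dist_le_mul fun x y => by
            rw [dist_eq_norm, dist_eq_norm]; exact norm_vertPrimitive_sub_le' hg hK hσ y x
        exact hLσ.continuous
      · filter_upwards [self_mem_nhdsWithin] with σ hσ
        exact ae_of_all _ fun w => hb _ (norm_vertPrimitive_sub_le' hg hK hσ) r hr y w
      · exact (((hlim _).sub (hlim _)).const_mul _).mul_const _
  -- Rademacher's theorem supplies the exceptional null set. Where `Φ` is differentiable, the
  -- difference quotients in the formula tend to `w Φ'(y)`, so the integrals converge.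
  filter_upwards [hLip.ae_differentiableAt] with y hy
  have hscale : Tendsto (fun r : ℝ => ∫ w : ℝ,
      ((r⁻¹ : ℝ) * (Φ (y + r * w) - Φ y)) * (2 * w / (1 + w ^ 2) ^ 2 : ℝ)) (𝓝[>] 0)
      (𝓝 (∫ w : ℝ, (w * deriv Φ y) * (2 * w / (1 + w ^ 2) ^ 2 : ℝ))) := by
    refine tendsto_integral_filter_of_dominated_convergence _ (Eventually.of_forall fun r =>
      hm Φ hLip.continuous r y) ?_ hbi (ae_of_all _ fun w => Tendsto.mul_const _ ?_)
    · filter_upwards [self_mem_nhdsWithin] with r hr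
      exact ae_of_all _ fun w => hb Φ hΦ r hr y w
    · have hd : HasDerivAt (fun r : ℝ => Φ (y + r * w)) (w * deriv Φ y) 0 := by
        have h1 : HasDerivAt (fun r : ℝ => y + r * w) w 0 := by
          simpa using ((hasDerivAt_id (0 : ℝ)).mul_const w).const_add y
        have h2 : HasDerivAt Φ (deriv Φ y) (y + 0 * w) := by simpa using hy.hasDerivAt
        simpa [Function.comp_def] using h2.scomp 0 h1
      simpa using hd.tendsto_slope_zero_right
  refine ⟨(Real.pi : ℂ)⁻¹ * ∫ w : ℝ, (w * deriv Φ y) * (2 * w / (1 + w ^ 2) ^ 2 : ℝ), ?_⟩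
  have hneg : Tendsto (fun σ : ℝ => -σ) (𝓝[<] 0) (𝓝[>] 0) := by
    simpa using tendsto_neg_nhdsLT (a := (0 : ℝ))
  refine ((hscale.comp hneg).const_mul ((Real.pi : ℂ)⁻¹)).congr' ?_
  filter_upwards [self_mem_nhdsWithin] with σ hσ
  rw [Function.comp_apply, ← hform (-σ) (neg_pos.2 hσ) y, inv_mul_cancel_left₀
    (Complex.ofReal_ne_zero.2 Real.pi_ne_zero), neg_neg]

/-- Fatou's theorem for `z ↦ g(2πz)`, matching the parametrization of the axis by `2πiξ`. It shows
that the limit in `boundary` is genuine off a null set. -/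
theorem ae_tendsto_boundary : ∀ᵐ ξ : ℝ,
    Tendsto (fun σ : ℝ => g (σ + 2 * Real.pi * ξ * I)) (𝓝[<] 0) (𝓝 (boundary g ξ)) := by
  have h2π : 0 < 2 * Real.pi := by positivity
  have hre : ∀ z : ℂ, z.re < 0 → ((2 * Real.pi : ℝ) * z : ℂ).re < 0 := fun z hz => by
    rw [Complex.re_ofReal_mul]; exact mul_neg_of_pos_of_neg h2π hz
  filter_upwards [ae_exists_tendsto_boundary (g := fun z => g ((2 * Real.pi : ℝ) * z))
    (hg.comp (by fun_prop) hre) (K := K) fun z hz => hK _ (hre z hz)] with ξ ⟨c, hc⟩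
  refine tendsto_nhds_limUnder ⟨c, ?_⟩
  have hs : Tendsto (fun σ : ℝ => σ / (2 * Real.pi)) (𝓝[<] 0) (𝓝[<] 0) := by
    refine tendsto_nhdsWithin_iff.2 ⟨?_, ?_⟩
    · have : Tendsto (fun σ : ℝ => σ / (2 * Real.pi)) (𝓝 0) (𝓝 (0 / (2 * Real.pi))) :=
        Continuous.tendsto (by fun_prop) 0
      rw [zero_div] at this
      exact this.mono_left nhdsWithin_le_nhds
    · filter_upwards [self_mem_nhdsWithin] with σ hσ
      exact div_neg_of_neg_of_pos hσ h2π
  refine (hc.comp hs).congr fun σ => ?_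
  have : (Real.pi : ℂ) ≠ 0 := Complex.ofReal_ne_zero.2 Real.pi_ne_zero
  simp only [Function.comp_apply]
  congr 1; push_cast; field_simp

theorem ae_norm_boundary_le : ∀ᵐ ξ : ℝ, ‖boundary g ξ‖ ≤ K := by
  filter_upwards [ae_tendsto_boundary hg hK] with ξ hξ
  refine le_of_tendsto hξ.norm ?_
  filter_upwards [self_mem_nhdsWithin] with σ hσ
  exact hK _ (by simpa using hσ)

theorem aestronglyMeasurable_boundary : AEStronglyMeasurable (boundary g) := by
  refine aestronglyMeasurable_of_tendsto_ae atTop (f := fun (n : ℕ) (ξ : ℝ) =>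
    g ((-(1 / ((n : ℝ) + 1)) : ℝ) + 2 * Real.pi * ξ * I)) (fun n => ?_) ?_
  · have := continuous_vertical hg (σ := -(1 / ((n : ℝ) + 1)))
      (neg_lt_zero.2 Nat.one_div_pos_of_nat) 0 (2 * Real.pi)
    refine Continuous.aestronglyMeasurable (this.congr fun t => ?_)
    push_cast; simp
  · filter_upwards [ae_tendsto_boundary hg hK] with ξ hξ
    refine hξ.comp (tendsto_nhdsWithin_iff.2 ⟨?_, Eventually.of_forall fun n =>
      show -(1 / ((n : ℝ) + 1)) < 0 from neg_lt_zero.2 Nat.one_div_pos_of_nat⟩)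
    simpa using (tendsto_one_div_add_atTop_nhds_zero_nat (𝕜 := ℝ)).neg

/-- Cauchy's formula for the boundary function, against a product of two Cauchy kernels. -/
theorem integral_boundary_mul_pairKernel {l m : ℂ} (hl : 0 < l.re) (hm : 0 < m.re) :
    ∫ ξ : ℝ, boundary g ξ * pairKernel l m (2 * Real.pi * ξ) =
      g (-l) * ∫ ξ : ℝ, pairKernel l m (2 * Real.pi * ξ) := by
  have h2π : 2 * Real.pi ≠ 0 := by positivity
  have hker : Integrable fun ξ : ℝ => pairKernel l m (2 * Real.pi * ξ) :=
    (integrable_pairKernel hl hm).comp_mul_left' h2π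
  -- The translate `g(· + σ)` is holomorphic on the closed half-plane, so the earlier formula
  -- applies to it; `σ ↑ 0` then follows by dominated convergence.
  have hσ : ∀ σ : ℝ, σ < 0 → ∫ ξ : ℝ, g (σ + 2 * Real.pi * ξ * I) * pairKernel l m (2 * Real.pi * ξ)
      = g (-l + σ) * ∫ ξ : ℝ, pairKernel l m (2 * Real.pi * ξ) := fun σ hσ => by
    have hre : ∀ z : ℂ, z.re ≤ 0 → (z + σ : ℂ).re < 0 := fun z hz => by
      simp; linarith
    have := integral_mul_pairKernel (g := fun z => g (z + σ)) (hg.comp (by fun_prop) hre) (K := K)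
      (fun z hz => hK _ (hre z hz)) hl hm
    have e := Measure.integral_comp_mul_left
      (fun y : ℝ => g (y * I + σ) * pairKernel l m y) (2 * Real.pi)
    rw [this] at e
    rw [Measure.integral_comp_mul_left (fun y : ℝ => pairKernel l m y), mul_smul_comm, ← e]
    refine integral_congr_ae (ae_of_all _ fun ξ => ?_)
    dsimp only
    congr 2; push_cast; ring
  have hlhs : Tendsto (fun σ : ℝ => ∫ ξ : ℝ,
      g (σ + 2 * Real.pi * ξ * I) * pairKernel l m (2 * Real.pi * ξ)) (𝓝[<] 0)
      (𝓝 (∫ ξ : ℝ, boundary g ξ * pairKernel l m (2 * Real.pi * ξ))) := by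
    refine tendsto_integral_filter_of_dominated_convergence
      (fun ξ => K * ‖pairKernel l m (2 * Real.pi * ξ)‖) ?_ ?_ (hker.norm.const_mul K) ?_
    · filter_upwards [self_mem_nhdsWithin] with σ hσ
      refine AEStronglyMeasurable.mul (Continuous.aestronglyMeasurable ?_)
        hker.aestronglyMeasurable
      refine (continuous_vertical hg hσ 0 (2 * Real.pi)).congr fun t => ?_
      push_cast; simp
    · filter_upwards [self_mem_nhdsWithin] with σ hσ
      refine ae_of_all _ fun ξ => ?_
      rw [norm_mul]
      gcongr
      exact hK _ (by simpa using hσ)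
    · filter_upwards [ae_tendsto_boundary hg hK] with ξ hξ using hξ.mul_const _
  have hrhs : Tendsto (fun σ : ℝ => g (-l + σ) * ∫ ξ : ℝ, pairKernel l m (2 * Real.pi * ξ))
      (𝓝[<] 0) (𝓝 (g (-l) * ∫ ξ : ℝ, pairKernel l m (2 * Real.pi * ξ))) := by
    refine Tendsto.mul_const _ ?_
    have hca : ContinuousAt (fun σ : ℝ => g (-l + σ)) 0 := by
      refine ContinuousAt.comp (g := g) ?_ (by fun_prop)
      exact (hg.differentiableAt ((isOpen_lt Complex.continuous_re continuous_const).mem_nhds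
        (by simpa using hl))).continuousAt
    simpa using hca.tendsto.mono_left nhdsWithin_le_nhds
  refine tendsto_nhds_unique hlhs (hrhs.congr' ?_)
  filter_upwards [self_mem_nhdsWithin] with σ h using (hσ σ h).symm

end

end WeakCalculus
end

noncomputable section

namespace WeakCalculus

open Complex (I)
open scoped ComplexConjugate

/-! ## The Laplace transform of exponentials -/

/-- On `L¹ ∩ L²`, the Fourier transform on `L²` is given by the Fourier integral. -/
theorem fourierTransformₗᵢ_toLp_ae_eq {f : ℝ → ℂ} (h1 : Integrable f) (h2 : MemLp f 2) :
    Lp.fourierTransformₗᵢ ℝ ℂ (h2.toLp f) =ᵐ[volume] 𝓕 f := by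
  set F : L2Line := h2.toLp f
  have hcont : Continuous (𝓕 f) := VectorFourier.fourierIntegral_continuous
    Real.continuous_fourierChar (by exact continuous_inner) h1
  refine ae_eq_of_integral_contDiff_smul_eq ((Lp.memLp _).locallyIntegrable one_le_two)
    hcont.locallyIntegrable fun φ hφ hsupp => ?_
  have hs : HasCompactSupport fun x => (φ x : ℂ) := hsupp.comp_left Complex.ofReal_zero
  set ψ : SchwartzMap ℝ ℂ := hs.toSchwartzMap (Complex.ofRealCLM.contDiff.comp hφ) with hψ
  -- The `L²` transform agrees with the distributional one, and the multiplication formula for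
  -- integrable functions identifies the latter with the Fourier integral when tested on `ψ`.
  have key := congrArg (fun D : TemperedDistribution ℝ ℂ => D ψ)
    (Lp.fourier_toTemperedDistribution_eq F)
  simp only [TemperedDistribution.fourier_apply, Lp.toTemperedDistribution_apply] at key
  have e1 : ∫ x, φ x • (Lp.fourierTransformₗᵢ ℝ ℂ F) x = ∫ x, ψ x • (𝓕 F : L2Line) x := by
    refine integral_congr_ae (ae_of_all _ fun x => ?_)
    change (φ x) • (Lp.fourierTransformₗᵢ ℝ ℂ F) x = (φ x : ℂ) • (Lp.fourierTransformₗᵢ ℝ ℂ F) x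
    rw [Complex.real_smul, smul_eq_mul]
  rw [e1, ← key]
  have e2 : ∫ x, (𝓕 ψ) x • F x = ∫ x, (𝓕 (ψ : ℝ → ℂ)) x • f x := by
    refine integral_congr_ae ?_
    filter_upwards [h2.coeFn_toLp] with x hx
    rw [hx, SchwartzMap.fourier_coe]
  rw [e2]
  have := VectorFourier.integral_fourierIntegral_smul_eq_flip (L := innerₗ ℝ) (μ := volume)
    (ν := volume) (f := ψ) (g := f) Real.continuous_fourierChar (by exact continuous_inner)
    ψ.integrable h1
  rw [flip_innerₗ] at this
  refine this.trans (integral_congr_ae (ae_of_all _ fun x => ?_))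
  change (φ x : ℂ) • 𝓕 f x = φ x • 𝓕 f x
  rw [Complex.real_smul, smul_eq_mul]

theorem norm_exp_neg_mul (l : ℂ) (t : ℝ) : ‖Complex.exp (-l * t)‖ = Real.exp (-l.re * t) := by
  rw [Complex.norm_exp]; simp

theorem integrableOn_exp_neg_mul {l : ℂ} (hl : 0 < l.re) :
    IntegrableOn (fun t : ℝ => Complex.exp (-l * t)) (Ioi 0) :=
  integrableOn_exp_mul_complex_Ioi (by simpa using hl) 0

theorem memLp_exp {l : ℂ} (hl : 0 < l.re) :
    MemLp (fun t : ℝ => Complex.exp (-l * t)) 2 (volume.restrict (Ioi (0 : ℝ))) := by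
  rw [memLp_two_iff_integrable_sq_norm (by fun_prop)]
  refine (integrableOn_exp_mul_Ioi (a := -(2 * l.re)) (by linarith) 0).congr
    (ae_of_all _ fun t => ?_)
  simp only [norm_exp_neg_mul, ← Real.exp_nat_mul]
  congr 1; push_cast; ring

/-- The exponential `t ↦ e^{-lt}` as an element of `L²(0,∞)`. -/
def expL2 {l : ℂ} (hl : 0 < l.re) : L2Pos := (memLp_exp hl).toLp _

theorem laplace_toLp_ae_eq {f : ℝ → ℂ} (h1 : IntegrableOn f (Ioi 0))
    (h2 : MemLp f 2 (volume.restrict (Ioi (0 : ℝ)))) :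
    laplace (h2.toLp f) =ᵐ[volume] fun ξ =>
      ∫ t in Ioi (0 : ℝ), Complex.exp (-(2 * Real.pi * ξ * I) * t) * f t := by
  have h2' : MemLp (indicator (Ioi (0 : ℝ)) f) 2 (volume : Measure ℝ) :=
    (memLp_indicator_iff_restrict measurableSet_Ioi).2 h2
  have e : zeroExt (h2.toLp f) = h2'.toLp _ := by
    change (memLp_zeroExt _).toLp _ = _
    rw [MemLp.toLp_eq_toLp_iff]
    filter_upwards [(ae_restrict_iff' measurableSet_Ioi).1 h2.coeFn_toLp] with t ht
    by_cases h : t ∈ Ioi (0 : ℝ)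
    · simpa [indicator_of_mem h] using ht h
    · simp [indicator_of_notMem h]
  change Lp.fourierTransformₗᵢ ℝ ℂ (zeroExt (h2.toLp f)) =ᵐ[volume] _
  rw [e]
  refine (fourierTransformₗᵢ_toLp_ae_eq ((integrable_indicator_iff measurableSet_Ioi).2 h1)
    h2').trans (ae_of_all _ fun ξ => ?_)
  dsimp only
  rw [Real.fourier_real_eq_integral_exp_smul, ← integral_indicator measurableSet_Ioi]
  refine integral_congr_ae (ae_of_all _ fun t => ?_)
  by_cases h : t ∈ Ioi (0 : ℝ)
  · simp only [indicator_of_mem h, smul_eq_mul]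
    congr 2; push_cast; ring
  · simp [indicator_of_notMem h]

theorem laplace_expL2 {l : ℂ} (hl : 0 < l.re) :
    laplace (expL2 hl) =ᵐ[volume] fun ξ => ((2 * Real.pi * ξ : ℝ) * I + l)⁻¹ := by
  refine (laplace_toLp_ae_eq (integrableOn_exp_neg_mul hl) (memLp_exp hl)).trans
    (ae_of_all _ fun ξ => ?_)
  have h := integral_exp_mul_complex_Ioi (a := -((2 * Real.pi * ξ : ℝ) * I + l))
    (by simpa using hl) 0
  rw [Complex.ofReal_zero, mul_zero, Complex.exp_zero, neg_div_neg_eq, one_div] at h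
  refine Eq.trans ?_ h
  refine integral_congr_ae (ae_of_all _ fun t => ?_)
  simp only [← Complex.exp_add]
  congr 1; push_cast; ring

theorem inner_expL2 {l : ℂ} (hl : 0 < l.re) (f : L2Pos) :
    inner ℂ (expL2 hl) f = ∫ t in Ioi (0 : ℝ), Complex.exp (-conj l * t) * f t := by
  rw [L2.inner_def]
  refine integral_congr_ae ?_
  filter_upwards [(memLp_exp hl).coeFn_toLp] with t ht
  rw [expL2, ht, RCLike.inner_apply', ← Complex.exp_conj]
  simp

/-- The exponentials are total in `L²(0,∞)`. -/
theorem eq_zero_of_inner_expL2_eq_zero {f : L2Pos}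
    (h : ∀ (l : ℂ) (hl : 0 < l.re), inner ℂ (expL2 hl) f = 0) : f = 0 := by
  have hexp : MemLp (fun t : ℝ => Complex.exp (-1 * t)) 2 (volume.restrict (Ioi (0 : ℝ))) :=
    memLp_exp (by simp)
  have h1 : IntegrableOn (fun t : ℝ => Complex.exp (-1 * t) * f t) (Ioi 0) :=
    hexp.integrable_mul (Lp.memLp f)
  have h2 : MemLp (fun t : ℝ => Complex.exp (-1 * t) * f t) 2
      (volume.restrict (Ioi (0 : ℝ))) := by
    refine (Lp.memLp f).of_le_mul (c := 1) h1.aestronglyMeasurable ?_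
    filter_upwards [ae_restrict_mem measurableSet_Ioi] with t ht
    rw [norm_mul, norm_exp_neg_mul]
    gcongr
    simpa using le_of_lt ht
  -- The damped function `e^{-t} f` is in `L¹ ∩ L²`, so its transform is a true integral; its value
  -- at `2πiξ` is the inner product of `f` with the exponential of parameter `1 - 2πiξ`.
  have h0 : laplace (h2.toLp _) = 0 := by
    refine Lp.ext ((laplace_toLp_ae_eq h1 h2).trans (EventuallyEq.trans (ae_of_all _ fun ξ => ?_)
      (Lp.coeFn_zero _ _ _).symm))
    rw [Pi.zero_apply, ← h (1 - (2 * Real.pi * ξ : ℝ) * I) (by simp), inner_expL2]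
    refine integral_congr_ae (ae_of_all _ fun t => ?_)
    dsimp only
    rw [← mul_assoc, ← Complex.exp_add, map_sub, map_one, map_mul, Complex.conj_ofReal,
      Complex.conj_I]
    congr 2; push_cast; ring
  have h3 : h2.toLp _ = 0 := laplace.injective (h0.trans (map_zero _).symm)
  refine Lp.ext (EventuallyEq.trans ?_ (Lp.coeFn_zero _ _ _).symm)
  have h4 := h2.coeFn_toLp
  rw [h3] at h4
  filter_upwards [h4, Lp.coeFn_zero ℂ 2 (volume.restrict (Ioi (0 : ℝ)))] with t ht h0t
  rw [h0t, Pi.zero_apply] at ht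
  simpa using ht.symm

theorem dense_span_expL2 :
    Dense (Submodule.span ℂ {f : L2Pos | ∃ (l : ℂ) (hl : 0 < l.re), f = expL2 hl} : Set L2Pos) := by
  rw [Submodule.dense_iff_topologicalClosure_eq_top, Submodule.topologicalClosure_eq_top_iff,
    Submodule.eq_bot_iff]
  exact fun f hf => eq_zero_of_inner_expL2_eq_zero fun l hl =>
    hf _ (Submodule.subset_span ⟨l, hl, rfl⟩)

theorem clm_ext_expL2 {E : Type*} [NormedAddCommGroup E] [NormedSpace ℂ E] {S S' : L2Pos →L[ℂ] E}
    (h : ∀ (l : ℂ) (hl : 0 < l.re), S (expL2 hl) = S' (expL2 hl)) : S = S' :=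
  ContinuousLinearMap.ext_on dense_span_expL2 (by rintro _ ⟨l, hl, rfl⟩; exact h l hl)

/-! ## Toeplitz operators -/

section Toeplitz

variable {g : ℂ → ℂ}

theorem memLp_boundary_mul (hg : IsHInfMinus g) (φ : L2Line) :
    MemLp (fun ξ : ℝ => boundary g ξ * φ ξ) 2 (volume : Measure ℝ) := by
  obtain ⟨hd, K, hK⟩ := hg
  refine (Lp.memLp φ).of_le_mul (c := K)
    ((aestronglyMeasurable_boundary hd hK).mul (Lp.aestronglyMeasurable φ)) ?_
  filter_upwards [ae_norm_boundary_le hd hK] with ξ hξ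
  rw [norm_mul]; gcongr

theorem boundaryMul_ae_eq (hg : IsHInfMinus g) (φ : L2Line) :
    boundaryMul g φ =ᵐ[volume] fun ξ => boundary g ξ * φ ξ := by
  rw [boundaryMul, dif_pos (memLp_boundary_mul hg φ)]
  exact MemLp.coeFn_toLp _

/-- Multiplication by the boundary function of `g`, as a bounded operator on `L²(iℝ)`. -/
def boundaryMulCLM (hg : IsHInfMinus g) : L2Line →L[ℂ] L2Line :=
  LinearMap.mkContinuous
    { toFun := boundaryMul g
      map_add' := fun φ ψ => by
        refine Lp.ext ?_
        filter_upwards [boundaryMul_ae_eq hg (φ + ψ), boundaryMul_ae_eq hg φ,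
          boundaryMul_ae_eq hg ψ, Lp.coeFn_add φ ψ,
          Lp.coeFn_add (boundaryMul g φ) (boundaryMul g ψ)] with ξ h1 h2 h3 h4 h5
        rw [h1, h5, Pi.add_apply, h2, h3, h4, Pi.add_apply, mul_add]
      map_smul' := fun c φ => by
        refine Lp.ext ?_
        filter_upwards [boundaryMul_ae_eq hg (c • φ), boundaryMul_ae_eq hg φ,
          Lp.coeFn_smul c φ, Lp.coeFn_smul c (boundaryMul g φ)] with ξ h1 h2 h3 h4
        rw [h1, RingHom.id_apply, h4, Pi.smul_apply, h2, h3, Pi.smul_apply, smul_eq_mul,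
          smul_eq_mul, mul_left_comm] }
    hg.2.choose fun φ => by
      refine Lp.norm_le_mul_norm_of_ae_le_mul ?_
      filter_upwards [boundaryMul_ae_eq hg φ, ae_norm_boundary_le hg.1 hg.2.choose_spec]
        with ξ h1 h2
      change ‖boundaryMul g φ ξ‖ ≤ _
      rw [h1, norm_mul]
      gcongr

/-- The Toeplitz operator `M_g` as a bounded operator. -/
def toeplitzCLM (hg : IsHInfMinus g) : L2Pos →L[ℂ] L2Pos :=
  (laplaceEquiv.symm.toContinuousLinearEquiv : hardy →L[ℂ] L2Pos) ∘L
    hardy.orthogonalProjectionOnto ∘L boundaryMulCLM hg ∘L laplace.toContinuousLinearMap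

theorem toeplitzCLM_apply (hg : IsHInfMinus g) (f : L2Pos) : toeplitzCLM hg f = toeplitz g f := rfl

/-- Against an element of `H²` the orthogonal projection disappears. -/
theorem inner_toeplitz (f h : L2Pos) :
    inner ℂ h (toeplitz g f) = inner ℂ (laplace h) (boundaryMul g (laplace f)) := by
  rw [toeplitz, ← laplaceEquiv.inner_map_map, LinearIsometryEquiv.apply_symm_apply]
  exact Submodule.inner_orthogonalProjectionOnto_eq_of_mem_left (laplaceEquiv h) _

theorem inner_laplace_expL2 {l m : ℂ} (hl : 0 < l.re) (hm : 0 < m.re) {φ : L2Line} {b : ℝ → ℂ}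
    (h : φ =ᵐ[volume] fun ξ => b ξ * laplace (expL2 hl) ξ) :
    inner ℂ (laplace (expL2 hm)) φ = ∫ ξ : ℝ, b ξ * pairKernel l (conj m) (2 * Real.pi * ξ) := by
  rw [L2.inner_def]
  refine integral_congr_ae ?_
  filter_upwards [laplace_expL2 hl, laplace_expL2 hm, h] with ξ h1 h2 h3
  rw [h3, h1, h2, RCLike.inner_apply', pairKernel, mul_inv, map_inv₀, map_add, map_mul,
    Complex.conj_ofReal, Complex.conj_I]
  rw [mul_neg, neg_add_eq_sub]; ring

/-- Exponentials are eigenvectors of the Toeplitz operators with symbol in `H^∞` of the left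
half-plane. -/
theorem toeplitz_expL2 (hg : IsHInfMinus g) {l : ℂ} (hl : 0 < l.re) :
    toeplitz g (expL2 hl) = g (-l) • expL2 hl := by
  refine sub_eq_zero.1 (eq_zero_of_inner_expL2_eq_zero fun m hm => ?_)
  obtain ⟨hd, K, hK⟩ := id hg
  -- Cauchy's formula pulls `g(-l)` out of the inner product with `e_m`; the remaining integral is
  -- `⟨e_m, e_l⟩`, the same computation with symbol `1`.
  rw [inner_sub_right, inner_toeplitz, inner_laplace_expL2 hl hm (boundaryMul_ae_eq hg _),
    inner_smul_right, ← laplace.inner_map_map, inner_laplace_expL2 hl hm (b := fun _ => 1)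
    (by simp), integral_boundary_mul_pairKernel hd hK hl (by simpa using hm)]
  simp

end Toeplitz

end WeakCalculus
end

noncomputable section

namespace WeakCalculus

open Complex (I)
open scoped ComplexConjugate

/-! ## The left shift semigroup -/

theorem measurePreserving_add_left_Ioi (t : ℝ) :
    MeasurePreserving (fun s : ℝ => t + s) (volume.restrict (Ioi 0)) (volume.restrict (Ioi t)) := by
  simpa using (measurePreserving_add_left volume t).restrict_preimage
    (measurableSet_Ioi (a := t))

theorem memLp_shift (t : ℝ≥0) (v : L2Pos) :
    MemLp (fun s : ℝ => v (t + s)) 2 (volume.restrict (Ioi (0 : ℝ))) :=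
  ((Lp.memLp v).mono_measure (Measure.restrict_mono (Ioi_subset_Ioi t.2) le_rfl)).comp_measurePreserving
    (measurePreserving_add_left_Ioi t)

theorem ae_shift {p : ℝ → Prop} (t : ℝ≥0) (h : ∀ᵐ s ∂(volume.restrict (Ioi (0 : ℝ))), p s) :
    ∀ᵐ s ∂(volume.restrict (Ioi (0 : ℝ))), p (t + s) :=
  (measurePreserving_add_left_Ioi t).quasiMeasurePreserving.ae
    (ae_mono (Measure.restrict_mono (Ioi_subset_Ioi t.2) le_rfl) h)

/-- The left shift `v ↦ v(t + ·)` on `L²(0,∞)`. -/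
def leftShift (t : ℝ≥0) : L2Pos →L[ℂ] L2Pos :=
  LinearMap.mkContinuous
    { toFun := fun v => (memLp_shift t v).toLp _
      map_add' := fun v w => by
        rw [← MemLp.toLp_add, MemLp.toLp_eq_toLp_iff]
        filter_upwards [ae_shift t (Lp.coeFn_add v w)] with s hs using hs
      map_smul' := fun c v => by
        rw [RingHom.id_apply, ← MemLp.toLp_const_smul, MemLp.toLp_eq_toLp_iff]
        filter_upwards [ae_shift t (Lp.coeFn_smul c v)] with s hs using hs }
    1 fun v => by
      change ‖(memLp_shift t v).toLp _‖ ≤ _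
      rw [Lp.norm_toLp, Lp.norm_def, one_mul]
      refine ENNReal.toReal_mono (Lp.eLpNorm_ne_top v) ?_
      have hm : Measure.restrict volume (Ioi (t : ℝ)) ≤ Measure.restrict volume (Ioi 0) :=
        Measure.restrict_mono (Ioi_subset_Ioi t.2) le_rfl
      have e := eLpNorm_comp_measurePreserving (p := 2) ((Lp.aestronglyMeasurable v).mono_measure hm)
        (measurePreserving_add_left_Ioi t)
      exact e.le.trans (eLpNorm_mono_measure _ hm)

theorem leftShift_toLp (t : ℝ≥0) {f : ℝ → ℂ} (hf : MemLp f 2 (volume.restrict (Ioi (0 : ℝ))))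
    (hf' : MemLp (fun s => f (t + s)) 2 (volume.restrict (Ioi (0 : ℝ)))) :
    leftShift t (hf.toLp f) = hf'.toLp _ := by
  change (memLp_shift t _).toLp _ = _
  rw [MemLp.toLp_eq_toLp_iff]
  exact ae_shift t hf.coeFn_toLp

theorem leftShift_expL2 (t : ℝ≥0) {l : ℂ} (hl : 0 < l.re) :
    leftShift t (expL2 hl) = Complex.exp (-l * t) • expL2 hl := by
  have e : (fun s : ℝ => Complex.exp (-l * (t + s : ℝ))) =
      Complex.exp (-l * t) • fun s : ℝ => Complex.exp (-l * s) := by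
    ext s
    rw [Pi.smul_apply, smul_eq_mul, ← Complex.exp_add]
    congr 1; push_cast; ring
  have hm : MemLp (fun s : ℝ => Complex.exp (-l * (t + s : ℝ))) 2
      (volume.restrict (Ioi (0 : ℝ))) := by
    rw [e]; exact (memLp_exp hl).const_smul _
  rw [expL2, leftShift_toLp t _ hm, ← MemLp.toLp_const_smul, MemLp.toLp_eq_toLp_iff, e]

/-- Two continuous maps on `L²(0,∞)`, one given by a pointwise continuous family of functionals,
agree if they agree on exponentials. -/
theorem ae_eq_of_expL2 {S : L2Pos →L[ℂ] L2Pos} {B : ℝ → L2Pos →L[ℂ] ℂ}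
    (h : ∀ (l : ℂ) (hl : 0 < l.re),
      ∀ᵐ t ∂(volume.restrict (Ioi (0 : ℝ))), S (expL2 hl) t = B t (expL2 hl)) (v : L2Pos) :
    ∀ᵐ t ∂(volume.restrict (Ioi (0 : ℝ))), S v t = B t v := by
  let W : Submodule ℂ L2Pos :=
    { carrier := {v | ∀ᵐ t ∂(volume.restrict (Ioi (0 : ℝ))), S v t = B t v}
      zero_mem' := by
        simp only [mem_ofPred_eq, map_zero]
        exact Lp.coeFn_zero _ _ _
      add_mem' := fun {a b} ha hb => by
        simp only [mem_ofPred_eq, map_add] at ha hb ⊢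
        filter_upwards [ha, hb, Lp.coeFn_add (S a) (S b)] with t h1 h2 h3
        rw [h3, Pi.add_apply, h1, h2]
      smul_mem' := fun c a ha => by
        simp only [mem_ofPred_eq, map_smul] at ha ⊢
        filter_upwards [ha, Lp.coeFn_smul c (S a)] with t h1 h2
        rw [h2, Pi.smul_apply, h1] }
  -- An `L²`-convergent sequence has an almost everywhere convergent subsequence, and each `B t` is
  -- continuous; no bound uniform in `t` is needed.
  have hclosed : IsClosed (W : Set L2Pos) := by
    refine IsSeqClosed.isClosed fun u w hu hw => ?_
    have hS := ((S.continuous.tendsto w).comp hw)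
    obtain ⟨ns, hns, hae⟩ := (tendstoInMeasure_of_tendsto_Lp hS).exists_seq_tendsto_ae
    have hall : ∀ᵐ t ∂(volume.restrict (Ioi (0 : ℝ))), ∀ n, S (u n) t = B t (u n) :=
      ae_all_iff.2 hu
    filter_upwards [hae, hall] with t h1 h2
    refine tendsto_nhds_unique h1 ?_
    simp only [Function.comp_apply, h2]
    exact ((B t).continuous.tendsto w).comp (hw.comp hns.tendsto_atTop)
  have hle : Submodule.span ℂ {f : L2Pos | ∃ (l : ℂ) (hl : 0 < l.re), f = expL2 hl} ≤ W :=
    Submodule.span_le.2 (by rintro _ ⟨l, hl, rfl⟩; exact h l hl)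
  have hd : Dense (W : Set L2Pos) := dense_span_expL2.mono hle
  have : v ∈ closure (W : Set L2Pos) := hd v
  rwa [hclosed.closure_eq] at this

/-! ## A Toeplitz operator as a correlation -/

theorem isHInfMinus_resolvent : IsHInfMinus fun z => (1 - z)⁻¹ := by
  refine ⟨DifferentiableOn.inv (by fun_prop) fun z hz h => ?_, 1, fun z hz => ?_⟩
  · have := congrArg Complex.re h
    simp only [mem_ofPred_eq] at hz
    simp at this; linarith
  · rw [norm_inv]
    refine inv_le_one_of_one_le₀ (le_trans ?_ (Complex.re_le_norm _))
    simp; linarith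

theorem isHInfMinus_one : IsHInfMinus fun _ => 1 :=
  ⟨by fun_prop, 1, by simp⟩

theorem toeplitz_one (f : L2Pos) : toeplitz (fun _ => 1) f = f := by
  have : toeplitzCLM isHInfMinus_one = ContinuousLinearMap.id ℂ L2Pos :=
    clm_ext_expL2 fun l hl => by
      rw [toeplitzCLM_apply, toeplitz_expL2 isHInfMinus_one hl, one_smul]; rfl
  rw [← toeplitzCLM_apply isHInfMinus_one, this]; rfl

/-- The exponential `e^{-t}` in `L²(0,∞)`. -/
def expOne : L2Pos := expL2 (l := 1) (by simp)

theorem inner_expOne (f : L2Pos) :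
    inner ℂ expOne f = ∫ t in Ioi (0 : ℝ), Complex.exp (-1 * t) * f t := by
  rw [expOne, inner_expL2, map_one]

theorem inner_expOne_expL2 {l : ℂ} (hl : 0 < l.re) :
    inner ℂ expOne (expL2 hl) = (1 + l)⁻¹ := by
  have h := integral_exp_mul_complex_Ioi (a := -(1 + l)) (by simp; linarith) 0
  rw [Complex.ofReal_zero, mul_zero, Complex.exp_zero, neg_div_neg_eq, one_div] at h
  rw [inner_expOne, ← h]
  refine integral_congr_ae ?_
  filter_upwards [(memLp_exp hl).coeFn_toLp] with t ht
  rw [expL2, ht, ← Complex.exp_add]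
  congr 1; ring

/-- The operator `M_g (1 - d/dt)⁻¹` is evaluated through a functional of left shifts. -/
theorem toeplitz_resolvent_ae_eq {g : ℂ → ℂ} (hg : IsHInfMinus g) (v : L2Pos) :
    ∀ᵐ t : ℝ ∂(volume.restrict (Ioi (0 : ℝ))), toeplitz g (toeplitz (fun z => (1 - z)⁻¹) v) t =
      inner ℂ expOne (toeplitz g (leftShift t.toNNReal v)) := by
  -- On `e_l` both sides equal `(1 + l)⁻¹ g(-l) e^{-lt}`: the factor `(1 + l)⁻¹` is the symbol at
  -- `-l` on the left and `⟨e_1, e_l⟩` on the right.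
  refine ae_eq_of_expL2 (S := toeplitzCLM hg ∘L toeplitzCLM isHInfMinus_resolvent)
    (B := fun t => innerSL ℂ expOne ∘L toeplitzCLM hg ∘L leftShift t.toNNReal) (fun l hl => ?_) v
  have e1 : (toeplitzCLM hg ∘L toeplitzCLM isHInfMinus_resolvent) (expL2 hl) =
      ((1 + l)⁻¹ * g (-l)) • expL2 hl := by
    rw [ContinuousLinearMap.comp_apply, toeplitzCLM_apply isHInfMinus_resolvent,
      toeplitz_expL2 isHInfMinus_resolvent hl, map_smul, toeplitzCLM_apply, toeplitz_expL2 hg hl,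
      smul_smul, sub_neg_eq_add]
  rw [e1]
  filter_upwards [Lp.coeFn_smul ((1 + l)⁻¹ * g (-l)) (expL2 hl), (memLp_exp hl).coeFn_toLp,
    ae_restrict_mem measurableSet_Ioi] with t h1 h2 ht
  change expL2 hl t = _ at h2
  rw [h1, Pi.smul_apply, h2]
  simp only [ContinuousLinearMap.comp_apply]
  rw [leftShift_expL2 _ hl, map_smul, map_smul, toeplitzCLM_apply, toeplitz_expL2 hg hl,
    innerSL_apply_apply, inner_smul_right, inner_expOne_expL2]
  simp only [smul_eq_mul, Real.coe_toNNReal t (le_of_lt ht)]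
  ring

end WeakCalculus
end

noncomputable section

namespace WeakCalculus

open scoped ComplexConjugate

variable {X : Type*} [NormedAddCommGroup X] [NormedSpace ℂ X]

namespace C0Semigroup

variable {T : C0Semigroup X}

/-! ## Operators `∫ φ(t) T(t) dt` -/

theorem continuous_orbit_real (T : C0Semigroup X) (x : X) :
    Continuous fun t : ℝ => T.op t.toNNReal x :=
  (T.continuous_orbit x).comp continuous_real_toNNReal

theorem op_comm (T : C0Semigroup X) (s t : ℝ≥0) (x : X) : T.op s (T.op t x) = T.op t (T.op s x) := by
  rw [← ContinuousLinearMap.comp_apply, ← ContinuousLinearMap.comp_apply, ← T.op_add,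
    ← T.op_add, add_comm]

theorem IsExpStable.exists_bound (hT : T.IsExpStable) : ∃ (M : ℝ) (b : ℝ → ℝ), 0 ≤ M ∧
    MemLp b 2 (volume.restrict (Ioi (0 : ℝ))) ∧ (∀ t : ℝ≥0, ‖T.op t‖ ≤ b t) ∧
      ∀ t : ℝ≥0, ‖T.op t‖ ≤ M := by
  obtain ⟨M, ω, hω, hM⟩ := hT
  have hM0 : 0 ≤ M := by simpa using (norm_nonneg _).trans (hM 0)
  refine ⟨M, fun t => M * Real.exp (ω * t), hM0, ?_, hM, fun t => (hM t).trans ?_⟩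
  · refine MemLp.const_mul ?_ _
    rw [memLp_two_iff_integrable_sq (by fun_prop)]
    refine (integrableOn_exp_mul_Ioi (a := 2 * ω) (by linarith) 0).congr (ae_of_all _ fun t => ?_)
    simp only [← Real.exp_nat_mul]
    congr 1; push_cast; ring
  · refine mul_le_of_le_one_right hM0 (Real.exp_le_one_iff.2 ?_)
    exact mul_nonpos_of_nonpos_of_nonneg hω.le t.2

/-- Both `φ` and the exponential bound on `‖T(·)‖` lie in `L²`, so their product is integrable. -/
theorem IsExpStable.exists_integral_bound (hT : T.IsExpStable) {φ : ℝ → ℂ}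
    (hφ : MemLp φ 2 (volume.restrict (Ioi (0 : ℝ)))) : ∃ b : ℝ → ℝ,
      IntegrableOn b (Ioi 0) ∧ ∀ t ∈ Ioi (0 : ℝ), ∀ x, ‖φ t • T.op t.toNNReal x‖ ≤ b t * ‖x‖ := by
  obtain ⟨M, b, -, hb, hbT, -⟩ := hT.exists_bound
  refine ⟨fun t => ‖φ t‖ * b t, hφ.norm.integrable_mul hb, fun t ht x => ?_⟩
  have h := hbT t.toNNReal
  rw [Real.coe_toNNReal t (le_of_lt ht)] at h
  rw [norm_smul, mul_assoc]
  gcongr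
  exact (T.op _).le_of_opNorm_le h x

theorem IsExpStable.integrable_smul_orbit (hT : T.IsExpStable) {φ : ℝ → ℂ}
    (hφ : MemLp φ 2 (volume.restrict (Ioi (0 : ℝ)))) (x : X) :
    IntegrableOn (fun t => φ t • T.op t.toNNReal x) (Ioi 0) := by
  obtain ⟨b, hb, hbT⟩ := hT.exists_integral_bound hφ
  refine (hb.mul_const ‖x‖).mono'
    (hφ.aestronglyMeasurable.smul (T.continuous_orbit_real x).aestronglyMeasurable) ?_
  filter_upwards [ae_restrict_mem measurableSet_Ioi] with t ht using hbT t ht x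

/-- The bounded operator `x ↦ ∫₀^∞ φ(t) T(t) x dt` for `φ ∈ L²(0,∞)`. -/
def orbitIntegral (hT : T.IsExpStable) {φ : ℝ → ℂ}
    (hφ : MemLp φ 2 (volume.restrict (Ioi (0 : ℝ)))) : X →L[ℂ] X :=
  LinearMap.mkContinuousOfExistsBound
    { toFun := fun x => ∫ t in Ioi (0 : ℝ), φ t • T.op t.toNNReal x
      map_add' := fun x y => by
        rw [← integral_add (hT.integrable_smul_orbit hφ x) (hT.integrable_smul_orbit hφ y)]
        simp only [map_add, smul_add]
      map_smul' := fun c x => by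
        rw [RingHom.id_apply, ← integral_smul]
        simp only [map_smul, smul_comm c] } <| by
    obtain ⟨b, hb, hbT⟩ := hT.exists_integral_bound hφ
    refine ⟨∫ t in Ioi (0 : ℝ), b t, fun x => ?_⟩
    rw [← integral_mul_const]
    refine norm_integral_le_of_norm_le (hb.mul_const ‖x‖) ?_
    filter_upwards [ae_restrict_mem measurableSet_Ioi] with t ht using hbT t ht x

section

variable (hT : T.IsExpStable) {φ : ℝ → ℂ} (hφ : MemLp φ 2 (volume.restrict (Ioi (0 : ℝ))))

theorem orbitIntegral_apply (x : X) :
    orbitIntegral hT hφ x = ∫ t in Ioi (0 : ℝ), φ t • T.op t.toNNReal x := rfl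

variable [CompleteSpace X]

theorem orbitIntegral_op (t : ℝ≥0) (x : X) :
    orbitIntegral hT hφ (T.op t x) = T.op t (orbitIntegral hT hφ x) := by
  rw [orbitIntegral_apply, orbitIntegral_apply,
    ← ContinuousLinearMap.integral_comp_comm _ (hT.integrable_smul_orbit hφ x)]
  refine integral_congr_ae (ae_of_all _ fun s => ?_)
  simp only [map_smul, T.op_comm t]

theorem dual_orbitIntegral (y : StrongDual ℂ X) (x : X) :
    y (orbitIntegral hT hφ x) = ∫ t in Ioi (0 : ℝ), φ t * weakOrbit hT y x t := by
  rw [orbitIntegral_apply, ← ContinuousLinearMap.integral_comp_comm _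
    (hT.integrable_smul_orbit hφ x)]
  refine integral_congr_ae ?_
  filter_upwards [(hT.memLp_orbit y x).coeFn_toLp] with t ht
  rw [weakOrbit, ht, map_smul, smul_eq_mul]

end

/-! ## Generator and resolvent -/

theorem generator_eq {x z : X} (h : Tendsto (T.quot x) (𝓝[>] 0) (𝓝 z)) :
    T.generator ⟨x, z, h⟩ = z := h.limUnder_eq

theorem tendsto_quot (u : T.generator.domain) :
    Tendsto (T.quot u) (𝓝[>] 0) (𝓝 (T.generator u)) := by
  obtain ⟨x, z, h⟩ := u
  rwa [generator_eq h]

theorem generator_apply_of_tendsto (u : T.generator.domain) {z : X}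
    (h : Tendsto (T.quot u) (𝓝[>] 0) (𝓝 z)) : T.generator u = z :=
  tendsto_nhds_unique (tendsto_quot u) h

theorem quot_map {S : X →L[ℂ] X} (hS : ∀ t x, S (T.op t x) = T.op t (S x)) (x : X) :
    T.quot (S x) = fun h => S (T.quot x h) := by
  ext h
  simp only [quot, map_smul, map_sub, hS]

theorem tendsto_quot_map {S : X →L[ℂ] X} (hS : ∀ t x, S (T.op t x) = T.op t (S x))
    (u : T.generator.domain) : Tendsto (T.quot (S u)) (𝓝[>] 0) (𝓝 (S (T.generator u))) := by
  rw [quot_map hS]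
  exact (S.continuous.tendsto _).comp (tendsto_quot u)

theorem generator_op (t : ℝ≥0) (u : T.generator.domain) :
    T.generator ⟨T.op t u, T.op_mem_domain t u.2⟩ = T.op t (T.generator u) :=
  generator_apply_of_tendsto _ (tendsto_quot_map (fun s x => T.op_comm t s x) u)

section

variable [CompleteSpace X]

/-- The semigroup law gives `T(h)R = e^{lh}(R - ∫₀ʰ e^{-ls} T(s)x ds)`; differentiate at `h = 0`. -/
theorem tendsto_quot_orbitIntegral_exp (hT : T.IsExpStable) {l : ℂ} (hl : 0 < l.re) (x : X) :
    Tendsto (T.quot (orbitIntegral hT (memLp_exp hl) x)) (𝓝[>] 0)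
      (𝓝 (l • orbitIntegral hT (memLp_exp hl) x - x)) := by
  set R := orbitIntegral hT (memLp_exp hl) x with hR
  set f : ℝ → X := fun s => Complex.exp (-l * s) • T.op s.toNNReal x with hf
  have hfc : Continuous f := by
    have := T.continuous_orbit_real x
    fun_prop
  set P : ℝ → X := fun h => ∫ s in (0 : ℝ)..h, f s with hP
  have hfi : IntegrableOn f (Ioi 0) := hT.integrable_smul_orbit (memLp_exp hl) x
  have hTR : ∀ h : ℝ≥0, T.op h R = Complex.exp (l * h) • (R - P h) := fun h => by
    have e1 : R - P h = ∫ s in Ioi (h : ℝ), f s := by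
      rw [sub_eq_iff_eq_add', hP, hR, orbitIntegral_apply]
      exact (intervalIntegral.integral_interval_add_Ioi hfi
        (hfi.mono_set (Ioi_subset_Ioi h.2))).symm
    rw [e1, ← (measurePreserving_add_left_Ioi (h : ℝ)).integral_comp
      (measurableEmbedding_addLeft _), hR, ← orbitIntegral_op, orbitIntegral_apply, ← integral_smul]
    refine setIntegral_congr_fun measurableSet_Ioi fun s hs => ?_
    rw [hf]
    dsimp only
    rw [smul_smul, ← Complex.exp_add, Real.toNNReal_add (NNReal.coe_nonneg h) (le_of_lt hs), Real.toNNReal_coe,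
      add_comm h, T.op_add, ContinuousLinearMap.comp_apply]
    congr 2; push_cast; ring
  have hP' : HasDerivAt P x 0 := by
    have := intervalIntegral.integral_hasDerivAt_right (hfc.intervalIntegrable 0 0)
      hfc.aestronglyMeasurable.stronglyMeasurableAtFilter hfc.continuousAt
    simpa [hP, hf, T.op_zero] using this
  have hE' : HasDerivAt (fun h : ℝ => Complex.exp (l * h)) l 0 := by
    have h1 : HasDerivAt (fun z : ℂ => Complex.exp (l * z)) l ((0 : ℝ) : ℂ) := by
      simpa using ((hasDerivAt_id (0 : ℂ)).const_mul l).cexp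
    exact h1.comp_ofReal
  have hQ : HasDerivAt (fun h : ℝ => Complex.exp (l * h) • (R - P h)) (l • R - x) 0 := by
    have h0 : P 0 = 0 := intervalIntegral.integral_same
    have := hE'.smul ((hasDerivAt_const (0 : ℝ) R).sub hP')
    simp only [zero_sub, Complex.ofReal_zero, mul_zero, Complex.exp_zero, one_smul, h0,
      sub_zero, Pi.sub_apply] at this
    rw [neg_add_eq_sub] at this
    exact this
  have hcoe : Tendsto ((↑) : ℝ≥0 → ℝ) (𝓝[>] 0) (𝓝[>] 0) :=
    tendsto_nhdsWithin_iff.2 ⟨(NNReal.continuous_coe.tendsto 0).mono_left nhdsWithin_le_nhds,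
      eventually_mem_nhdsWithin.mono fun h hh => NNReal.coe_pos.2 hh⟩
  refine (hQ.tendsto_slope_zero_right.comp hcoe).congr fun h => ?_
  simp only [Function.comp_apply, quot, zero_add, hTR]
  rw [← Complex.coe_smul, Complex.ofReal_inv]
  simp [hP]

/-- The integral operator `R` commutes with the semigroup, so the difference quotients of `Ru`
converge both to `RAu` and to `lRu - u`. -/
theorem orbitIntegral_exp_shift (hT : T.IsExpStable) {l : ℂ} (hl : 0 < l.re) (u : T.generator.domain) :
    orbitIntegral hT (memLp_exp hl) (shift T.generator l u) = u := by
  have h := tendsto_nhds_unique (tendsto_quot_map (orbitIntegral_op hT (memLp_exp hl)) u)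
    (tendsto_quot_orbitIntegral_exp hT hl u)
  change orbitIntegral hT (memLp_exp hl) (l • (u : X) - T.generator u) = u
  rw [map_sub, map_smul, h, sub_sub_cancel]

/-- The Laplace integral is a two-sided inverse of `l - A`, so the junk value in `resolv` does not
occur here. -/
theorem resolv_generator (hT : T.IsExpStable) {l : ℂ} (hl : 0 < l.re) (x : X) :
    ((resolv T.generator l x : T.generator.domain) : X) = orbitIntegral hT (memLp_exp hl) x := by
  set R := orbitIntegral hT (memLp_exp hl) with hR
  have hleft := orbitIntegral_exp_shift hT hl
  rw [← hR] at hleft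
  have hright : ∀ x, shift T.generator l ⟨R x, _, tendsto_quot_orbitIntegral_exp hT hl x⟩ = x :=
    fun x => by
      change l • R x - T.generator ⟨R x, _⟩ = x
      rw [generator_eq (tendsto_quot_orbitIntegral_exp hT hl x), sub_sub_cancel]
  have hbij : Function.Bijective (shift T.generator l) :=
    ⟨fun u v h => Subtype.ext (by rw [← hleft u, h, hleft v]), fun x => ⟨_, hright x⟩⟩
  rw [resolv, dif_pos hbij]
  have : (LinearEquiv.ofBijective (shift T.generator l) hbij).symm x =
      ⟨R x, _, tendsto_quot_orbitIntegral_exp hT hl x⟩ := by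
    rw [LinearEquiv.symm_apply_eq]
    exact (hright x).symm
  exact congrArg Subtype.val this

theorem resolv_op (hT : T.IsExpStable) {l : ℂ} (hl : 0 < l.re) (t : ℝ≥0) (x : X) :
    resolv T.generator l (T.op t x) =
      ⟨T.op t (resolv T.generator l x : T.generator.domain), T.op_mem_domain t (Subtype.prop _)⟩ := by
  refine Subtype.ext ?_
  rw [resolv_generator hT hl]
  simp only [resolv_generator hT hl, orbitIntegral_op]

/-- Substituting `s = lt` turns the expression into `∫ e^{-s} T(s/l)x ds`, which tends to `∫ e^{-s}
x ds = x` by dominated convergence. -/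
theorem tendsto_smul_resolv (hT : T.IsExpStable) (x : X) :
    Tendsto (fun l : ℝ => (l : ℂ) • ((resolv T.generator l x : T.generator.domain) : X)) atTop
      (𝓝 x) := by
  obtain ⟨M, -, hM0, -, -, hM⟩ := hT.exists_bound
  have hexp : IntegrableOn (fun s : ℝ => Real.exp (-s)) (Ioi 0) := integrableOn_exp_neg_Ioi 0
  have hone : ∫ s in Ioi (0 : ℝ), Real.exp (-s) • x = x := by
    rw [integral_smul_const, integral_exp_neg_Ioi_zero, one_smul]
  have hlim : Tendsto (fun l : ℝ => ∫ s in Ioi (0 : ℝ),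
      Real.exp (-s) • T.op (s / l).toNNReal x) atTop (𝓝 x) := by
    nth_rw 2 [← hone]
    refine tendsto_integral_filter_of_dominated_convergence (fun s => Real.exp (-s) * (M * ‖x‖))
      (Eventually.of_forall fun l => ?_) (Eventually.of_forall fun l => ae_of_all _ fun s => ?_)
      (hexp.mul_const _) (ae_of_all _ fun s => Tendsto.const_smul ?_ _)
    · have := (T.continuous_orbit_real x).comp (continuous_id.div_const l)
      simp only [Function.comp_def, id] at this
      exact Continuous.aestronglyMeasurable (by fun_prop)
    · rw [norm_smul, Real.norm_of_nonneg (Real.exp_pos _).le]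
      gcongr
      exact (T.op _).le_of_opNorm_le (hM _) x
    · have h0 : Tendsto (fun l : ℝ => s / l) atTop (𝓝 0) := tendsto_const_nhds.div_atTop tendsto_id
      simpa [Function.comp_def, T.op_zero] using ((T.continuous_orbit_real x).tendsto 0).comp h0
  refine hlim.congr' ?_
  filter_upwards [eventually_gt_atTop 0] with l hl
  rw [resolv_generator hT (l := l) (by simpa using hl), orbitIntegral_apply]
  have h := integral_comp_mul_left_Ioi (fun s : ℝ => Real.exp (-s) • T.op (s / l).toNNReal x) 0 hl
  rw [mul_zero, eq_inv_smul_iff₀ hl.ne'] at h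
  rw [← h, Complex.coe_smul]
  congr 1
  refine integral_congr_ae (ae_of_all _ fun t => ?_)
  dsimp only
  rw [mul_div_cancel_left₀ _ hl.ne', ← Complex.coe_smul]
  congr 1; push_cast; ring_nf

end

end C0Semigroup

end WeakCalculus
end

noncomputable section

namespace WeakCalculus

open scoped ComplexConjugate

variable {X : Type*} [NormedAddCommGroup X] [NormedSpace ℂ X]

/-- The kernel representing the functional `f ↦ ⟨e^{-t}, M_g f⟩`. -/
def toeplitzKernel {g : ℂ → ℂ} (hg : IsHInfMinus g) (t : ℝ) : ℂ :=
  conj ((toeplitzCLM hg).adjoint expOne t)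

theorem memLp_toeplitzKernel {g : ℂ → ℂ} (hg : IsHInfMinus g) :
    MemLp (toeplitzKernel hg) 2 (volume.restrict (Ioi (0 : ℝ))) :=
  (Lp.memLp ((toeplitzCLM hg).adjoint expOne)).star

theorem integral_toeplitzKernel_mul {g : ℂ → ℂ} (hg : IsHInfMinus g) (f : L2Pos) :
    ∫ t in Ioi (0 : ℝ), toeplitzKernel hg t * f t = inner ℂ expOne (toeplitz g f) := by
  rw [← toeplitzCLM_apply hg, ← ContinuousLinearMap.adjoint_inner_left, L2.inner_def]
  exact integral_congr_ae (ae_of_all _ fun t => by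
    dsimp only
    rw [RCLike.inner_apply']; rfl)

namespace C0Semigroup

variable {T : C0Semigroup X}

/-! ## Weak orbits -/

theorem leftShift_weakOrbit (hT : T.IsExpStable) (t : ℝ≥0) (y : StrongDual ℂ X) (x : X) :
    leftShift t (weakOrbit hT y x) = weakOrbit hT y (T.op t x) := by
  have e : ∀ᵐ s : ℝ ∂(volume.restrict (Ioi (0 : ℝ))),
      y (T.op (t + s).toNNReal x) = y (T.op s.toNNReal (T.op t x)) := by
    filter_upwards [ae_restrict_mem measurableSet_Ioi] with s hs
    rw [Real.toNNReal_add (NNReal.coe_nonneg t) (le_of_lt hs), Real.toNNReal_coe, add_comm t, T.op_add,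
      ContinuousLinearMap.comp_apply]
  have hm : MemLp (fun s : ℝ => y (T.op (t + s).toNNReal x)) 2 (volume.restrict (Ioi (0 : ℝ))) :=
    (hT.memLp_orbit y (T.op t x)).ae_eq (e.mono fun _ h => h.symm)
  rw [weakOrbit, leftShift_toLp t _ hm, weakOrbit, MemLp.toLp_eq_toLp_iff]
  exact e

/-- `x ↦ ⟨y, T(·)x⟩` as a bounded operator into `L²(0,∞)`. -/
def weakOrbitCLM (hT : T.IsExpStable) (y : StrongDual ℂ X) : X →L[ℂ] L2Pos :=
  LinearMap.mkContinuousOfExistsBound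
    { toFun := weakOrbit hT y
      map_add' := fun x z => by
        rw [weakOrbit, weakOrbit, weakOrbit, ← MemLp.toLp_add, MemLp.toLp_eq_toLp_iff]
        exact ae_of_all _ fun t => by simp
      map_smul' := fun c x => by
        rw [weakOrbit, weakOrbit, RingHom.id_apply, ← MemLp.toLp_const_smul,
          MemLp.toLp_eq_toLp_iff]
        exact ae_of_all _ fun t => by simp } <| by
    obtain ⟨-, b, -, hb, hbT, -⟩ := hT.exists_bound
    refine ⟨‖y‖ * ‖hb.toLp b‖, fun x => ?_⟩
    change ‖weakOrbit hT y x‖ ≤ _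
    rw [mul_right_comm]
    refine Lp.norm_le_mul_norm_of_ae_le_mul ?_
    filter_upwards [hb.coeFn_toLp, (hT.memLp_orbit y x).coeFn_toLp,
      ae_restrict_mem measurableSet_Ioi] with t h1 h2 ht
    rw [weakOrbit, h1, h2]
    have h := hbT t.toNNReal
    rw [Real.coe_toNNReal t (le_of_lt ht)] at h
    calc ‖y (T.op t.toNNReal x)‖ ≤ ‖y‖ * (b t * ‖x‖) :=
          y.le_of_opNorm_le_of_le le_rfl ((T.op _).le_of_opNorm_le h x)
      _ ≤ ‖y‖ * (‖b t‖ * ‖x‖) := by gcongr; exact le_abs_self _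
      _ = ‖y‖ * ‖x‖ * ‖b t‖ := by ring

/-! ## The operator `g(A)` -/

/-- The operator `u ↦ ∫₀^∞ k(t) T(t) (1 - A) u dt` on `D(A)`, where `k` is the Toeplitz kernel
of `g`; it is `g(A)`. -/
def kernelOp (hT : T.IsExpStable) {g : ℂ → ℂ} (hg : IsHInfMinus g) : T.generator.domain →ₗ[ℂ] X :=
  (orbitIntegral hT (memLp_toeplitzKernel hg)).toLinearMap ∘ₗ shift T.generator 1

theorem kernelOp_apply (hT : T.IsExpStable) {g : ℂ → ℂ} (hg : IsHInfMinus g)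
    (u : T.generator.domain) :
    kernelOp hT hg u =
      orbitIntegral hT (memLp_toeplitzKernel hg) (shift T.generator 1 u) := rfl

theorem shift_op (l : ℂ) (t : ℝ≥0) (u : T.generator.domain) :
    shift T.generator l ⟨T.op t u, T.op_mem_domain t u.2⟩ = T.op t (shift T.generator l u) := by
  change l • T.op t u - T.generator ⟨T.op t u, _⟩ = T.op t (l • (u : X) - T.generator u)
  rw [generator_op, map_sub, map_smul]

/-- Since `A T(t)u = T(t)Au`, the orbit of `u ∈ D(A)` is continuous in the graph norm. -/
theorem IsCalculusOp.continuous_orbit {hT : T.IsExpStable} {g : ℂ → ℂ}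
    {C : T.generator.domain →ₗ[ℂ] X} (hC : IsCalculusOp hT g C) (u : T.generator.domain) :
    Continuous fun t : ℝ => C ⟨T.op t.toNNReal u, T.op_mem_domain t.toNNReal u.2⟩ := by
  obtain ⟨⟨K, hK⟩, -⟩ := hC
  refine continuous_iff_continuousAt.2 fun s => tendsto_iff_norm_sub_tendsto_zero.2 ?_
  have hlim : Tendsto (fun t : ℝ => K * (‖T.op t.toNNReal u - T.op s.toNNReal u‖ +
      ‖T.op t.toNNReal (T.generator u) - T.op s.toNNReal (T.generator u)‖)) (𝓝 s) (𝓝 0) := by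
    have h1 := (T.continuous_orbit_real (u : X)).sub (continuous_const (y := T.op s.toNNReal u))
    have h2 := (T.continuous_orbit_real (T.generator u)).sub
      (continuous_const (y := T.op s.toNNReal (T.generator u)))
    have := ((h1.norm.add h2.norm).const_mul K).tendsto s
    simpa using this
  refine squeeze_zero (fun t => norm_nonneg _) (fun t => ?_) hlim
  rw [← map_sub]
  refine (hK _).trans (le_of_eq ?_)
  rw [LinearPMap.map_sub, generator_op, generator_op]
  rfl

/-- The weak orbits agree almost everywhere and are continuous, hence agree on `(0,∞)` and, by
closure, at `t = 0`; functionals separate points. -/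
theorem IsCalculusOp.unique {hT : T.IsExpStable} {g : ℂ → ℂ}
    {C C' : T.generator.domain →ₗ[ℂ] X} (hC : IsCalculusOp hT g C) (hC' : IsCalculusOp hT g C') :
    C = C' := by
  refine LinearMap.ext fun u => ?_
  refine (SeparatingDual.eq_iff_forall_dual_eq (R := ℂ)).2 fun y => ?_
  have hae : (fun t : ℝ => y (C ⟨T.op t.toNNReal u, T.op_mem_domain t.toNNReal u.2⟩))
      =ᵐ[volume.restrict (Ioi (0 : ℝ))]
      fun t : ℝ => y (C' ⟨T.op t.toNNReal u, T.op_mem_domain t.toNNReal u.2⟩) := by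
    filter_upwards [hC.2 y u, hC'.2 y u] with t h1 h2 using h1.trans h2.symm
  have hc := y.continuous.comp (hC.continuous_orbit u)
  have hc' := y.continuous.comp (hC'.continuous_orbit u)
  have heq : EqOn _ _ (Ioi (0 : ℝ)) := Measure.eqOn_open_of_ae_eq hae isOpen_Ioi
    hc.continuousOn hc'.continuousOn
  have h0 := heq.closure hc hc' (x := 0) (by rw [closure_Ioi]; exact self_mem_Ici)
  simpa [T.op_zero] using h0

theorem lambdaExt_eq {C : T.generator.domain →ₗ[ℂ] X} {x z : X}
    (h : Tendsto (lambdaNet T.generator C x) atTop (𝓝 z)) :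
    lambdaExt T.generator C ⟨x, z, h⟩ = z := h.limUnder_eq

variable [CompleteSpace X]

theorem dual_orbitIntegral_toeplitzKernel (hT : T.IsExpStable) {g : ℂ → ℂ} (hg : IsHInfMinus g)
    (y : StrongDual ℂ X) (x : X) :
    y (orbitIntegral hT (memLp_toeplitzKernel hg) x) =
      inner ℂ expOne (toeplitz g (weakOrbit hT y x)) := by
  rw [dual_orbitIntegral, integral_toeplitzKernel_mul]

/-- The correlation identity with `g = 1`: its right side at `t` is `⟨y, R(1,A)T(t)(1 - A)u⟩ = ⟨y,
T(t)u⟩`. -/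
theorem toeplitz_resolvent_weakOrbit (hT : T.IsExpStable) (y : StrongDual ℂ X)
    (u : T.generator.domain) :
    toeplitz (fun z => (1 - z)⁻¹) (weakOrbit hT y (shift T.generator 1 u)) = weakOrbit hT y u := by
  have h1 : 0 < (1 : ℂ).re := by simp
  refine Lp.ext ?_
  filter_upwards [toeplitz_resolvent_ae_eq isHInfMinus_one
    (weakOrbit hT y (shift T.generator 1 u)), (hT.memLp_orbit y u).coeFn_toLp] with t e1 e2
  rw [toeplitz_one, toeplitz_one, leftShift_weakOrbit, inner_expOne,
    ← dual_orbitIntegral hT (memLp_exp h1), orbitIntegral_op,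
    orbitIntegral_exp_shift hT h1] at e1
  rw [e1, weakOrbit, e2]

theorem kernelOp_op (hT : T.IsExpStable) {g : ℂ → ℂ} (hg : IsHInfMinus g) (t : ℝ≥0)
    (u : T.generator.domain) :
    kernelOp hT hg ⟨T.op t u, T.op_mem_domain t u.2⟩ = T.op t (kernelOp hT hg u) := by
  rw [kernelOp_apply, shift_op, orbitIntegral_op, kernelOp_apply]

/-- The correlation identity is applied to `⟨y, T(·)(1 - A)u⟩`, whose left shifts are again weak
orbits and whose image under the symbol `(1 - z)⁻¹` is `⟨y, T(·)u⟩`. -/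
theorem isCalculusOp_kernelOp (hT : T.IsExpStable) {g : ℂ → ℂ} (hg : IsHInfMinus g) :
    IsCalculusOp hT g (kernelOp hT hg) := by
  refine ⟨⟨‖orbitIntegral hT (memLp_toeplitzKernel hg)‖, fun u => ?_⟩, fun y u => ?_⟩
  · rw [kernelOp_apply]
    refine (ContinuousLinearMap.le_opNorm _ _).trans ?_
    gcongr
    change ‖(1 : ℂ) • (u : X) - T.generator u‖ ≤ _
    rw [one_smul]
    exact norm_sub_le _ _
  · filter_upwards [toeplitz_resolvent_ae_eq hg (weakOrbit hT y (shift T.generator 1 u))]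
      with t ht
    rw [toeplitz_resolvent_weakOrbit, leftShift_weakOrbit] at ht
    rw [kernelOp_apply, shift_op, dual_orbitIntegral_toeplitzKernel, outputMap, ht]

theorem calculusOp_eq_kernelOp (hT : T.IsExpStable) {g : ℂ → ℂ} (hg : IsHInfMinus g) :
    calculusOp hT g = kernelOp hT hg := by
  have h : ∃ C, IsCalculusOp hT g C := ⟨_, isCalculusOp_kernelOp hT hg⟩
  rw [calculusOp, dif_pos h]
  exact h.choose_spec.unique (isCalculusOp_kernelOp hT hg)

/-! ### Passage to the Lambda extension -/

theorem tendsto_lambdaNet_op (hT : T.IsExpStable) {g : ℂ → ℂ} (hg : IsHInfMinus g) {x z : X}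
    (h : Tendsto (lambdaNet T.generator (kernelOp hT hg) x) atTop (𝓝 z)) (t : ℝ≥0) :
    Tendsto (lambdaNet T.generator (kernelOp hT hg) (T.op t x)) atTop (𝓝 (T.op t z)) := by
  refine (((T.op t).continuous.tendsto z).comp h).congr' ?_
  filter_upwards [eventually_gt_atTop 0] with l hl
  rw [Function.comp_apply, lambdaNet, lambdaNet, resolv_op hT (by simpa using hl), kernelOp_op,
    map_smul]

theorem outputMap_eq_weakOrbit (hT : T.IsExpStable) {g : ℂ → ℂ} (hg : IsHInfMinus g)
    (y : StrongDual ℂ X) (u : T.generator.domain) :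
    outputMap hT g y u = weakOrbit hT y (kernelOp hT hg u) := by
  refine Lp.ext ?_
  filter_upwards [(isCalculusOp_kernelOp hT hg).2 y u,
    (hT.memLp_orbit y (kernelOp hT hg u)).coeFn_toLp] with t h1 h2
  rw [← h1, weakOrbit, h2, kernelOp_op]

/-- The identity on `D(A)` is applied to `λR(λ,A)x`. Both sides converge in `L²` because the output
map and the weak orbit map are bounded. -/
theorem outputMap_eq_weakOrbit_of_tendsto (hT : T.IsExpStable) {g : ℂ → ℂ} (hg : IsHInfMinus g)
    (y : StrongDual ℂ X) {x z : X}
    (h : Tendsto (lambdaNet T.generator (kernelOp hT hg) x) atTop (𝓝 z)) :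
    outputMap hT g y x = weakOrbit hT y z := by
  have h1 := ((toeplitzCLM hg ∘L weakOrbitCLM hT y).continuous.tendsto x).comp
    (tendsto_smul_resolv hT x)
  have h2 := ((weakOrbitCLM hT y).continuous.tendsto z).comp h
  refine tendsto_nhds_unique h1 (h2.congr fun l => ?_)
  have := outputMap_eq_weakOrbit hT hg y ((l : ℂ) • resolv T.generator l x)
  rw [map_smul] at this
  exact this.symm

end C0Semigroup

end WeakCalculus

end

theorem proposition2p15 {X : Type*} [NormedAddCommGroup X] [NormedSpace ℂ X] [CompleteSpace X]
    (T : WeakCalculus.C0Semigroup X) (hT : T.IsExpStable)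
    (g : ℂ → ℂ) (hg : WeakCalculus.IsHInfMinus g) :
    (∃! C : T.generator.domain →ₗ[ℂ] X, WeakCalculus.C0Semigroup.IsCalculusOp hT g C) ∧
    ∀ (y : StrongDual ℂ X) (x : X),
      x ∈ (WeakCalculus.C0Semigroup.calculusLambda hT g).domain →
      ∃ h : ∀ t : ℝ≥0, T.op t x ∈ (WeakCalculus.C0Semigroup.calculusLambda hT g).domain,
        ∀ᵐ t : ℝ ∂(volume.restrict (Ioi (0 : ℝ))),
          y (WeakCalculus.C0Semigroup.calculusLambda hT g ⟨T.op t.toNNReal x, h t.toNNReal⟩) =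
            (WeakCalculus.C0Semigroup.outputMap hT g y x : ℝ → ℂ) t := by
  refine ⟨⟨_, WeakCalculus.C0Semigroup.isCalculusOp_kernelOp hT hg, fun C hC =>
    hC.unique (WeakCalculus.C0Semigroup.isCalculusOp_kernelOp hT hg)⟩, ?_⟩
  rw [WeakCalculus.C0Semigroup.calculusLambda,
    WeakCalculus.C0Semigroup.calculusOp_eq_kernelOp hT hg]
  rintro y x ⟨z, hz⟩
  have h := WeakCalculus.C0Semigroup.tendsto_lambdaNet_op hT hg hz
  refine ⟨fun t => ⟨_, h t⟩, ?_⟩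
  -- Both sides reduce to `⟨y, T(t)z⟩`: the Lambda extension maps `T(t)x` to `T(t)z`.
  rw [WeakCalculus.C0Semigroup.outputMap_eq_weakOrbit_of_tendsto hT hg y hz]
  filter_upwards [(hT.memLp_orbit y z).coeFn_toLp] with t ht
  rw [WeakCalculus.C0Semigroup.lambdaExt_eq (h _), WeakCalculus.C0Semigroup.weakOrbit, ht]
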